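/- Let $p$ be an odd prime and let $k=\mathbb{F}_p$ be the field of $p$ elements. For a finite $p$-group $X$, let $(\gamma_i(X))_{i\ge 1}$ be the lower central series (with $\gamma_1(X)=X$), $(Z_i(X))_{i\ge 1}$ the upper central series, $\Phi(X)$ the Frattini subgroup, $\Gamma(X)=Z_1(X)\cap\gamma_2(X)$, and, for a subgroup $N$ of $X$, $N^p=\langle x^p : x\in N\rangle$. Write $I(kX)$ for the augmentation ideal of the group algebra $kX$. The small group algebra of $kX$ is $kX/I(kX)I(k\gamma_2(X))$, and $S_X=V\big(kX/I(kX)I(k\gamma_2(X))\big)$ denotes its group of normalized units, that is, the group of the elements that map to $1$ modulo the Jacobson radical. Let $G$ be a finite $p$-group with $\gamma_2(G)^p\gamma_4(G)=1$ and $|G:\Phi(G)|=|G:Z_2(G)|=p^3$, and assume that one of the following holds: (1) $|\gamma_2(G):\Gamma(G)|=p^3$; (2) $|\gamma_3(G)|=p$. Then the isomorphism type of $G$ is determined by the normalized units of the small group algebra of $kG$: if $H$ is a finite $p$-group such that $\gamma_2(H)^p\gamma_4(H)=1$ or $|H|=|G|$, and if $S_G\cong S_H$ as groups, then $G\cong H$.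 -/

import Mathlib

universe u v

namespace SmallGroupAlgebra

/-! ### Subgroups of a group `G` -/

section Groups

variable (G : Type u) [Group G]

/-- `γ_i(G)`, with the usual indexing `γ_1(G) = G`, `γ_{i+1}(G) = [γ_i(G), G]`
(Mathlib's lower central series starts with index `0`). Only used for `i ≥ 1`. -/
def gam (i : ℕ) : Subgroup G := (⊤ : Subgroup G).lowerCentralSeries (i - 1)

instance gam_normal (i : ℕ) : (gam G i).Normal := by
  unfold gam; infer_instance

/-- `Γ(G) = Z(G) ∩ γ_2(G)`. -/
def capGam : Subgroup G := Subgroup.center G ⊓ gam G 2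

variable {G} in
/-- `N ^ p`, the subgroup generated by the `p`-th powers of the elements of `N`. -/
def powSubgroup (p : ℕ) (N : Subgroup G) : Subgroup G :=
  Subgroup.closure {z | ∃ x ∈ N, x ^ p = z}

/-- The condition `γ_2(G)^p γ_4(G) = 1`. -/
def PowGamTrivial (p : ℕ) : Prop := powSubgroup p (gam G 2) ⊔ gam G 4 = ⊥

end Groups

/-! ### The small group algebra -/

section Algebra

variable (p : ℕ) (G : Type u) [Group G]

/-- The augmentation map `kG → k`, `∑ λ_g g ↦ ∑ λ_g`, where `k = ZMod p`. -/
noncomputable def aug : MonoidAlgebra (ZMod p) G →ₐ[ZMod p] ZMod p :=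
  MonoidAlgebra.lift (ZMod p) (ZMod p) G 1

/-- The augmentation ideal `I(kG)`. -/
noncomputable def augIdeal : Ideal (MonoidAlgebra (ZMod p) G) := RingHom.ker (aug p G)

instance augIdeal_isTwoSided : (augIdeal p G).IsTwoSided := by
  unfold augIdeal; infer_instance

variable {G} in
/-- `kG I(kN)`, the left ideal of `kG` generated by the augmentation ideal `I(kN)` of a subgroup
`N ≤ G`, where `kN` is mapped to `kG` in the obvious way. It is two-sided if `N` is normal. -/
noncomputable def augIdealOf (N : Subgroup G) : Ideal (MonoidAlgebra (ZMod p) G) :=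
  (augIdeal p N).map (MonoidAlgebra.mapDomainRingHom (ZMod p) N.subtype)

instance augIdealOf_isTwoSided (N : Subgroup G) [hN : N.Normal] :
    (augIdealOf p N).IsTwoSided := by
  have key : ∀ (g : G) (c : ZMod p) (y : MonoidAlgebra (ZMod p) N), y ∈ augIdeal p N →
      MonoidAlgebra.mapDomainRingHom (ZMod p) N.subtype y * MonoidAlgebra.single g c ∈
        augIdealOf p N := by
    intro g c y hy
    let f : N →* N := (MulAut.conjNormal (H := N) g⁻¹).toMonoidHom
    have h1 : MonoidAlgebra.mapDomainRingHom (ZMod p) N.subtype y * MonoidAlgebra.single g c =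
        MonoidAlgebra.single g c * MonoidAlgebra.mapDomainRingHom (ZMod p) N.subtype
          (MonoidAlgebra.mapDomainRingHom (ZMod p) f y) := by
      clear hy
      induction y using MonoidAlgebra.induction_linear with
      | zero => simp
      | add a b ha hb => simp only [map_add, add_mul, mul_add, ha, hb]
      | single n r =>
        simp [MonoidAlgebra.single_mul_single, f, mul_comm, mul_assoc]
    have h2 : aug p N (MonoidAlgebra.mapDomainRingHom (ZMod p) f y) = aug p N y := by
      clear hy h1
      induction y using MonoidAlgebra.induction_linear with
      | zero => simp
      | add a b ha hb => simp only [map_add, ha, hb]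
      | single n r => simp [aug]
    rw [h1]
    refine Ideal.mul_mem_left _ _ (Ideal.mem_map_of_mem _ ?_)
    show aug p N _ = 0
    rw [h2]
    exact hy
  refine ⟨fun {a} b ha => ?_⟩
  induction ha using Submodule.span_induction with
  | mem x hx =>
    obtain ⟨y, hy, rfl⟩ := hx
    induction b using MonoidAlgebra.induction_linear with
    | zero => simp
    | add b c hb hc => rw [mul_add]; exact add_mem hb hc
    | single g c => exact key g c y hy
  | zero => simp
  | add x y _ _ hx hy => rw [add_mul]; exact add_mem hx hy
  | smul r x _ hx => rw [smul_mul_assoc]; exact Submodule.smul_mem _ r hx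

/-- The ideal `I(kG) I(k γ_2(G))` of `kG`. As `I(kG) kG = I(kG)`, it is the same as the product
of the ideals `I(kG)` and `kG I(k γ_2(G))`, which is the form used here. -/
noncomputable def smallIdeal : Ideal (MonoidAlgebra (ZMod p) G) :=
  augIdeal p G * augIdealOf p (gam G 2)

instance smallIdeal_isTwoSided : (smallIdeal p G).IsTwoSided := by
  unfold smallIdeal; infer_instance

/-- The small group algebra `kG / I(kG) I(k γ_2(G))`. -/
abbrev SmallAlgebra : Type u := MonoidAlgebra (ZMod p) G ⧸ smallIdeal p G

end Algebra

/-- `V(A)`: the units of the (local) ring `A` that map to the identity modulo the Jacobson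
radical of `A`. -/
def normalizedUnits (A : Type u) [Ring A] : Subgroup Aˣ where
  carrier := {a | (a : A) - 1 ∈ Ring.jacobson A}
  one_mem' := by simp
  mul_mem' := by
    intro a b ha hb
    have h : ((a * b : Aˣ) : A) - 1 = (a : A) * ((b : A) - 1) + ((a : A) - 1) := by
      push_cast; noncomm_ring
    show ((a * b : Aˣ) : A) - 1 ∈ Ring.jacobson A
    rw [h]
    exact add_mem (Submodule.smul_mem _ (a : A) hb) ha
  inv_mem' := by
    intro a ha
    have h : ((a⁻¹ : Aˣ) : A) - 1 = -(((a⁻¹ : Aˣ) : A) * ((a : A) - 1)) := by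
      rw [mul_sub, Units.inv_mul]; simp
    show ((a⁻¹ : Aˣ) : A) - 1 ∈ Ring.jacobson A
    rw [h]
    exact neg_mem (Submodule.smul_mem _ ((a⁻¹ : Aˣ) : A) ha)

/-- `S_G = V(kG / I(kG) I(k γ_2(G)))`, the group of normalized units of the small group
algebra of `kG`, where `k = ZMod p`. -/
abbrev SmallUnits (p : ℕ) (G : Type u) [Group G] : Type u :=
  normalizedUnits (SmallAlgebra p G)

end SmallGroupAlgebra

/-! Let A be the small group algebra of G, I its augmentation ideal, S its group of normalized
units, and J the kernel of A → k(G/γ_2). Everything rests on two facts: J consists of the elements n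
- 1 with n ∈ γ_2(G), and IJ = 0. They show that γ_i(S) is the image of γ_i(G) for i = 2, 3, 4
(`gam_two_eq`, `gam_succ_eq`). If γ_4 = 1, they also show that the elements of I² commute with each
other and that JI² = 0.

An isomorphism F : S_G → S_H therefore restricts to f : γ_2(G) → γ_2(H). It need not send G to H,
but by `exists_eq_embS_mul` a unit u with u^(p^e) ∈ γ_2(S), e ≥ 1, is a product yw, where y is a
group element, u^(p^e) = y^(p^e), and w ∈ 1 + I² centralizes γ_2 and is central modulo γ_3. Let x_i
lift a basis of G/γ_2, with orders p^(e_i). Applied to F(x_i), this yields y_i ∈ H such that f([n,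
x_i]) = [f(n), y_i] and f(x_i^(p^(e_i))) = y_i^(p^(e_i)) hold exactly, while f([x_i, x_j]) = [y_i,
y_j] holds only modulo γ_3.

The error is removed by replacing f(n) with f(n D(n)), for a homomorphism D : γ_2 → γ_3 trivial on
Γ, and y_i with y_i n_i, for n_i ∈ γ_2. Finding D is linear algebra over F_p
(`exists_linearMap_cross`) with the vectors c_i ∈ γ_3^3 of entries [[x_(i+1), x_(i+2)], x_j],
indices modulo 3. If |γ_2 : Γ| = p^3, the c_i are independent and D takes any prescribed values. If
|γ_3| = p, the hypothesis |G : Z_2| = p^3 leaves at most a line of relations between the c_i, and a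
suitable choice of the n_i absorbs the resulting obstruction.

The corrected data extend to a homomorphism G → H by a graph argument
(`exists_monoidHom_of_compatible`). It agrees with F on generators up to units central modulo γ_3,
hence is onto (`surjective_of_agree`). Counting units gives |G| = |H|
(`card_eq_of_smallUnits_equiv`). -/

open scoped commutatorElement

namespace SmallGroupAlgebra

/-! ### Kernels of maps of group algebras -/

section KernelOfMapDomain

variable {R : Type*} [CommRing R] {X Y : Type*} [Group X] [Group Y]

/-- Replacing each g by `s (f g)`, in the same coset of the kernel, changes x by an element of K;
the replacement depends only on the image of x, which is 0. -/
theorem mem_of_mapDomainRingHom_eq_zero (f : X →* Y) (K : AddSubgroup (MonoidAlgebra R X))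
    (hK : ∀ (g : X), ∀ n ∈ f.ker, ∀ c : R,
      MonoidAlgebra.single (g * n) c - MonoidAlgebra.single g c ∈ K)
    (x : MonoidAlgebra R X) (hx : MonoidAlgebra.mapDomainRingHom R f x = 0) : x ∈ K := by
  let s : Y → X := Function.invFun f
  have key : ∀ x : MonoidAlgebra R X,
      x - MonoidAlgebra.mapDomain s (MonoidAlgebra.mapDomainRingHom R f x) ∈ K := by
    intro x
    induction x using MonoidAlgebra.induction_linear with
    | zero => simp
    | add a b ha hb =>
      rw [map_add, MonoidAlgebra.mapDomain_add, add_sub_add_comm]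
      exact add_mem ha hb
    | single g c =>
      have h1 : f (s (f g)) = f g := Function.invFun_eq ⟨g, rfl⟩
      have h2 := hK (s (f g)) ((s (f g))⁻¹ * g) (by simp [MonoidHom.mem_ker, h1]) c
      simpa using h2
  have h := key x
  rwa [hx, MonoidAlgebra.mapDomain_zero, sub_zero] at h

end KernelOfMapDomain

/-! ### The small group algebra and its projection to k(G/γ_2) -/

section Ring

variable (p : ℕ) (G : Type u) [Group G]

/-- The natural map from `G` to its small group algebra. -/
noncomputable def emb : G →* SmallAlgebra p G :=
  (Ideal.Quotient.mk (smallIdeal p G) : _ →* _).comp (MonoidAlgebra.of (ZMod p) G)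

theorem emb_apply (g : G) :
    emb p G g = Ideal.Quotient.mk (smallIdeal p G) (MonoidAlgebra.single g 1) := rfl

theorem aug_single (g : G) (c : ZMod p) : aug p G (MonoidAlgebra.single g c) = c := by
  simp [aug]

theorem mem_augIdeal_iff (x : MonoidAlgebra (ZMod p) G) : x ∈ augIdeal p G ↔ aug p G x = 0 :=
  RingHom.mem_ker

theorem single_sub_one_mem_augIdeal (g : G) :
    MonoidAlgebra.single g 1 - 1 ∈ augIdeal p G := by
  rw [mem_augIdeal_iff, map_sub, aug_single, map_one, sub_self]

theorem smallIdeal_le_augIdeal : smallIdeal p G ≤ augIdeal p G := by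
  refine Ideal.mul_le.2 fun x hx y _ => ?_
  exact Ideal.mul_mem_right y _ hx

/-- The augmentation of the small group algebra. -/
noncomputable def eps : SmallAlgebra p G →+* ZMod p :=
  Ideal.Quotient.lift (smallIdeal p G) (aug p G : MonoidAlgebra (ZMod p) G →+* ZMod p)
    fun a ha => (mem_augIdeal_iff p G a).1 (smallIdeal_le_augIdeal p G ha)

theorem eps_mk (x : MonoidAlgebra (ZMod p) G) :
    eps p G (Ideal.Quotient.mk (smallIdeal p G) x) = aug p G x := rfl

theorem eps_emb (g : G) : eps p G (emb p G g) = 1 := by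
  rw [emb_apply, eps_mk, aug_single]

/-- The map `kG → k(G/γ_2(G))`. -/
noncomputable def abMap :
    MonoidAlgebra (ZMod p) G →+* MonoidAlgebra (ZMod p) (Abelianization G) :=
  MonoidAlgebra.mapDomainRingHom (ZMod p) Abelianization.of

theorem gam_two : gam G 2 = commutator G := rfl

theorem of_eq_one_iff (g : G) : Abelianization.of g = 1 ↔ g ∈ gam G 2 := by
  rw [gam_two, ← Abelianization.ker_of, MonoidHom.mem_ker]

theorem augIdealOf_le_ker_abMap : augIdealOf p (gam G 2) ≤ RingHom.ker (abMap p G) := by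
  rw [augIdealOf, Ideal.map_le_iff_le_comap]
  intro y hy
  rw [Ideal.mem_comap, RingHom.mem_ker, abMap]
  have : ∀ y : MonoidAlgebra (ZMod p) (gam G 2),
      MonoidAlgebra.mapDomainRingHom (ZMod p) (Abelianization.of (G := G))
        (MonoidAlgebra.mapDomainRingHom (ZMod p) (gam G 2).subtype y) =
      MonoidAlgebra.single 1 (aug p _ y) := by
    intro y
    induction y using MonoidAlgebra.induction_linear with
    | zero => simp
    | add a b ha hb => simp only [map_add, ha, hb, MonoidAlgebra.single_add]
    | single n c =>
      have := (of_eq_one_iff G n).2 n.2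
      simp [aug_single, this]
  rw [this, (mem_augIdeal_iff p _ y).1 hy, MonoidAlgebra.single_zero]

theorem smallIdeal_le_ker_abMap : smallIdeal p G ≤ RingHom.ker (abMap p G) :=
  le_trans (Ideal.mul_le.2 fun x _ _ hy => Ideal.mul_mem_left _ x hy) (augIdealOf_le_ker_abMap p G)

/-- The projection of the small group algebra onto `k(G/γ_2(G))`. -/
noncomputable def proj : SmallAlgebra p G →+* MonoidAlgebra (ZMod p) (Abelianization G) :=
  Ideal.Quotient.lift (smallIdeal p G) (abMap p G)
    fun _ ha => RingHom.mem_ker.1 (smallIdeal_le_ker_abMap p G ha)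

theorem proj_mk (x : MonoidAlgebra (ZMod p) G) :
    proj p G (Ideal.Quotient.mk (smallIdeal p G) x) = abMap p G x := rfl

theorem proj_emb (g : G) :
    proj p G (emb p G g) = MonoidAlgebra.single (Abelianization.of g) 1 := by
  rw [emb_apply, proj_mk]; simp [abMap]

variable {p G}

theorem aug_proj (x : SmallAlgebra p G) : aug p _ (proj p G x) = eps p G x := by
  obtain ⟨x, rfl⟩ := Ideal.Quotient.mk_surjective x
  rw [proj_mk, eps_mk]
  induction x using MonoidAlgebra.induction_linear with
  | zero => simp
  | add a b ha hb => simp only [map_add, ha, hb]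
  | single g c => simp [abMap, aug_single]

theorem single_one_sub_one_mem_augIdealOf {n : G} (hn : n ∈ gam G 2) :
    MonoidAlgebra.single n 1 - 1 ∈ augIdealOf p (gam G 2) := by
  have h := Ideal.mem_map_of_mem (MonoidAlgebra.mapDomainRingHom (ZMod p) (gam G 2).subtype)
    (single_sub_one_mem_augIdeal p (gam G 2) ⟨n, hn⟩)
  rwa [map_sub, map_one, MonoidAlgebra.mapDomainRingHom_apply, MonoidAlgebra.mapDomain_single] at h

/-- This is the relation IJ = 0. -/
theorem mul_emb_sub_one {x : SmallAlgebra p G} (hx : eps p G x = 0) {n : G}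
    (hn : n ∈ gam G 2) : x * (emb p G n - 1) = 0 := by
  obtain ⟨x, rfl⟩ := Ideal.Quotient.mk_surjective x
  have h1 : x * (MonoidAlgebra.single n 1 - 1) ∈ smallIdeal p G :=
    Ideal.mul_mem_mul ((mem_augIdeal_iff p G x).2 hx) (single_one_sub_one_mem_augIdealOf hn)
  have h2 := Ideal.Quotient.eq_zero_iff_mem.2 h1
  rwa [map_mul, map_sub, map_one] at h2

theorem emb_mul_emb_sub_one (g : G) {n : G} (hn : n ∈ gam G 2) :
    emb p G g * (emb p G n - 1) = emb p G n - 1 := by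
  have h := mul_emb_sub_one (p := p) (x := emb p G g - 1) (by simp [eps_emb]) hn
  rwa [sub_mul, one_mul, sub_eq_zero] at h

theorem emb_sub_one_mul_emb (g : G) {n : G} (hn : n ∈ gam G 2) :
    (emb p G n - 1) * emb p G g = emb p G (g⁻¹ * n * g) - 1 := by
  have hm : g⁻¹ * n * g ∈ gam G 2 := by
    simpa using (gam_normal G 2).conj_mem n hn g⁻¹
  rw [← emb_mul_emb_sub_one g hm, mul_sub, sub_mul, mul_one, one_mul, ← map_mul, ← map_mul]
  congr 2; group

/-- Since m(n - 1) = n - 1, multiplication in γ_2 becomes addition in J. -/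
theorem emb_mul_sub_one {m n : G} (hn : n ∈ gam G 2) :
    emb p G (m * n) - 1 = (emb p G m - 1) + (emb p G n - 1) := by
  have h := emb_mul_emb_sub_one (p := p) m hn
  rw [mul_sub, mul_one, ← map_mul] at h
  rw [← sub_add_cancel (emb p G (m * n)) (emb p G m), h]; abel

/-- Although IJ = 0, the product JI records group commutators: right multiplication by I takes γ_i -
1 into γ_(i+1) - 1. -/
theorem emb_sub_one_mul_emb_sub_one (g : G) {n : G} (hn : n ∈ gam G 2) :
    (emb p G n - 1) * (emb p G g - 1) = emb p G ⁅n⁻¹, g⁻¹⁆ - 1 := by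
  have hc : ⁅n⁻¹, g⁻¹⁆ ∈ gam G 2 :=
    Subgroup.commutator_mem_commutator (Subgroup.mem_top _) (Subgroup.mem_top _)
  rw [mul_sub, mul_one, emb_sub_one_mul_emb g hn]
  have : g⁻¹ * n * g = n * ⁅n⁻¹, g⁻¹⁆ := by simp [commutatorElement_def, mul_assoc]
  rw [this, emb_mul_sub_one hc]; abel

/-- The additive group of the elements `n - 1` of the small group algebra, where `n` runs through
a subgroup of `γ_2(G)`. -/
noncomputable def subOne (p : ℕ) (M : Subgroup G) (hM : M ≤ gam G 2) :
    AddSubgroup (SmallAlgebra p G) where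
  carrier := {x | ∃ n ∈ M, emb p G n - 1 = x}
  zero_mem' := ⟨1, one_mem _, by simp⟩
  add_mem' := by
    rintro _ _ ⟨m, hm, rfl⟩ ⟨n, hn, rfl⟩
    exact ⟨m * n, mul_mem hm hn, emb_mul_sub_one (hM hn)⟩
  neg_mem' := by
    rintro _ ⟨m, hm, rfl⟩
    refine ⟨m⁻¹, inv_mem hm, ?_⟩
    have h := emb_mul_sub_one (p := p) (m := m) (hM (inv_mem hm))
    rw [mul_inv_cancel, map_one, sub_self] at h
    exact (neg_eq_of_add_eq_zero_right h.symm).symm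

theorem mem_subOne {M : Subgroup G} {hM : M ≤ gam G 2} {x : SmallAlgebra p G} :
    x ∈ subOne p M hM ↔ ∃ n ∈ M, emb p G n - 1 = x := Iff.rfl

variable [Fact p.Prime]

theorem single_eq_nsmul {X : Type*} (g : X) (c : ZMod p) :
    MonoidAlgebra.single g c = c.val • MonoidAlgebra.single g (1 : ZMod p) := by
  rw [MonoidAlgebra.smul_single]; simp

theorem mk_single (g : G) (c : ZMod p) :
    Ideal.Quotient.mk (smallIdeal p G) (MonoidAlgebra.single g c) = c.val • emb p G g := by
  rw [single_eq_nsmul, map_nsmul, emb_apply]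

/-- The coefficients lie in the prime field, so the elements g - 1 already generate I as an additive
group. -/
theorem mem_of_eps_eq_zero (K : AddSubgroup (SmallAlgebra p G))
    (hK : ∀ g, emb p G g - 1 ∈ K) (x : SmallAlgebra p G) (hx : eps p G x = 0) : x ∈ K := by
  obtain ⟨x, rfl⟩ := Ideal.Quotient.mk_surjective x
  have key : ∀ x : MonoidAlgebra (ZMod p) G,
      Ideal.Quotient.mk (smallIdeal p G) (x - MonoidAlgebra.single 1 (aug p G x)) ∈ K := by
    intro x
    induction x using MonoidAlgebra.induction_linear with
    | zero => simp
    | add a b ha hb =>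
      rw [map_add, MonoidAlgebra.single_add, add_sub_add_comm, map_add]; exact add_mem ha hb
    | single g c =>
      rw [aug_single, map_sub, mk_single, mk_single, ← smul_sub, map_one]
      exact nsmul_mem (hK g) _
  have h := key x
  rwa [← eps_mk, hx, MonoidAlgebra.single_zero, sub_zero] at h

theorem proj_eq_zero_iff {x : SmallAlgebra p G} :
    proj p G x = 0 ↔ x ∈ subOne p (gam G 2) le_rfl := by
  constructor
  · intro hx
    obtain ⟨x, rfl⟩ := Ideal.Quotient.mk_surjective x
    refine mem_of_mapDomainRingHom_eq_zero Abelianization.of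
      ((subOne p (gam G 2) le_rfl).comap
        (Ideal.Quotient.mk (smallIdeal p G) : _ →+* _).toAddMonoidHom) ?_ x hx
    intro g n hn c
    have hn' : n ∈ gam G 2 := (of_eq_one_iff G n).1 hn
    change Ideal.Quotient.mk (smallIdeal p G) _ ∈ subOne p (gam G 2) le_rfl
    rw [map_sub, mk_single, mk_single, ← smul_sub]
    refine nsmul_mem (mem_subOne.2 ⟨n, hn', ?_⟩) _
    rw [map_mul, ← emb_mul_emb_sub_one g hn', mul_sub, mul_one]
  · rintro ⟨n, hn, rfl⟩
    rw [map_sub, proj_emb, (of_eq_one_iff G n).2 hn, map_one, ← MonoidAlgebra.one_def, sub_self]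

theorem proj_surjective : Function.Surjective (proj p G) := by
  intro y
  induction y using MonoidAlgebra.induction_linear with
  | zero => exact ⟨0, map_zero _⟩
  | add a b ha hb =>
    obtain ⟨a, rfl⟩ := ha
    obtain ⟨b, rfl⟩ := hb
    exact ⟨a + b, map_add _ _ _⟩
  | single g c =>
    obtain ⟨g, rfl⟩ := QuotientGroup.mk_surjective g
    refine ⟨Ideal.Quotient.mk _ (MonoidAlgebra.single g c), ?_⟩
    rw [proj_mk]; simp [abMap]; rfl

theorem eps_eq_zero_of_proj_eq_zero {x : SmallAlgebra p G} (hx : proj p G x = 0) :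
    eps p G x = 0 := by rw [← aug_proj, hx, map_zero]

theorem mul_eq_zero_of_eps_of_proj {x y : SmallAlgebra p G} (hx : eps p G x = 0)
    (hy : proj p G y = 0) : x * y = 0 := by
  obtain ⟨n, hn, rfl⟩ := proj_eq_zero_iff.1 hy
  exact mul_emb_sub_one hx hn

/-- `γ_2(G)` embeds into the small group algebra if it is elementary abelian. -/
theorem emb_injOn (hab : ∀ a ∈ gam G 2, ∀ b ∈ gam G 2, a * b = b * a)
    (hexp : ∀ a ∈ gam G 2, a ^ p = 1) {n : G} (hn : n ∈ gam G 2) (h1 : emb p G n = 1) :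
    n = 1 := by
  classical
  let N := gam G 2
  let _ : CommGroup N := { (inferInstance : Group N) with
    mul_comm := fun a b => Subtype.ext (hab a a.2 b b.2) }
  let _ : Module (ZMod p) (Additive N) := AddCommGroup.zmodModule fun x => by
    have : (Additive.toMul x) ^ p = 1 := Subtype.ext (hexp _ (Additive.toMul x).2)
    exact this
  obtain ⟨s, hs1, hs⟩ : ∃ s : G ⧸ N → G, s (1 : G) = 1 ∧ ∀ q, (s q : G ⧸ N) = q := by
    refine ⟨fun q => if q = ((1 : G) : G ⧸ N) then 1 else q.out, by simp, fun q => ?_⟩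
    dsimp only
    split_ifs with hq
    · exact hq.symm
    · exact QuotientGroup.out_eq' q
  -- `ν` is the γ_2-component relative to the transversal `s`; the choice s(1) = 1 makes it the
  -- identity on γ_2. Its linear extension `L` obeys the product rule `hmul`, so it kills
  -- I(kG)I(kγ_2), yet it sends n - 1 to n.
  let ν : G → N := fun g => ⟨(s g)⁻¹ * g, QuotientGroup.eq.1 (hs g)⟩
  have hν : ∀ (g : G) (n : N), ν (g * n) = ν g * n := by
    intro g n
    have : ((g * n : G) : G ⧸ N) = g := by
      rw [QuotientGroup.eq]; simp
    apply Subtype.ext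
    simp [ν, this, mul_assoc]
  have hν1 : ν 1 = 1 := Subtype.ext (by change (s ((1 : G) : G ⧸ N))⁻¹ * 1 = 1; rw [hs1]; simp)
  let L : MonoidAlgebra (ZMod p) G →+ Additive N :=
    (Finsupp.lsum (ZMod p) fun g => LinearMap.toSpanSingleton (ZMod p) _
      (Additive.ofMul (ν g))).toAddMonoidHom.comp
      (MonoidAlgebra.coeffAddEquiv (R := ZMod p) (M := G)).toAddMonoidHom
  have hL : ∀ g c, L (MonoidAlgebra.single g c) = c • Additive.ofMul (ν g) := by
    intro g c
    simp [L]
  have hmul : ∀ (x : MonoidAlgebra (ZMod p) G) (y : MonoidAlgebra (ZMod p) N),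
      L (x * MonoidAlgebra.mapDomainRingHom (ZMod p) N.subtype y) =
        aug p N y • L x +
        aug p G x • L (MonoidAlgebra.mapDomainRingHom (ZMod p) N.subtype y) := by
    intro x y
    induction x using MonoidAlgebra.induction_linear with
    | zero => simp
    | add a b ha hb => rw [add_mul, map_add, ha, hb, map_add, map_add, smul_add, add_smul]; abel
    | single g c =>
      induction y using MonoidAlgebra.induction_linear with
      | zero => simp
      | add a b ha hb => simp only [mul_add, map_add, ha, hb, smul_add, add_smul]; abel
      | single n d =>
        have e1 : ν (n : G) = n := by rw [← one_mul (n : G), hν, hν1, one_mul]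
        have e2 := hν g n
        simp only [MonoidAlgebra.mapDomainRingHom_apply, MonoidAlgebra.mapDomain_single,
          Subgroup.coe_subtype, MonoidAlgebra.single_mul_single, hL, e1, e2, aug_single,
          ofMul_mul, smul_add, smul_smul]
        rw [mul_comm c d]
  have hker : ∀ z ∈ smallIdeal p G, L z = 0 := by
    intro z hz
    refine Submodule.mul_induction_on hz ?_ ?_
    · intro x hx y hy
      rw [mem_augIdeal_iff] at hx
      revert x
      refine Submodule.span_induction ?_ ?_ ?_ ?_ hy
      · rintro _ ⟨y, hy, rfl⟩ x hx
        rw [hmul, hx, (mem_augIdeal_iff p _ y).1 hy, zero_smul, zero_smul, add_zero]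
      · intro x _; simp
      · intro a b _ _ ha hb x hx; rw [mul_add, map_add, ha x hx, hb x hx, add_zero]
      · intro a b _ hb x hx
        rw [smul_eq_mul, ← mul_assoc]
        exact hb _ (by rw [map_mul, hx, zero_mul])
    · intro x y hx hy; rw [map_add, hx, hy, add_zero]
  have hmem : MonoidAlgebra.single n 1 - 1 ∈ smallIdeal p G := by
    rw [← Ideal.Quotient.eq_zero_iff_mem, map_sub, ← emb_apply, h1, map_one, sub_self]
  have h2 := hker _ hmem
  have e1 : ν n = ⟨n, hn⟩ := by
    have := hν 1 ⟨n, hn⟩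
    rwa [hν1, one_mul, one_mul] at this
  rw [map_sub, MonoidAlgebra.one_def, hL, hL, e1, hν1, one_smul, one_smul, ofMul_one,
    sub_zero] at h2
  exact congrArg Subtype.val (ofMul_eq_zero.1 h2)

end Ring

/-! ### Products, Lie commutators and p-th powers in the augmentation ideal -/

section RingStructure

variable {p : ℕ} [Fact p.Prime] {G : Type u} [Group G]

theorem charP_of_natCast_eq_zero {R : Type*} [Ring R] [Nontrivial R] (h : (p : R) = 0) :
    CharP R p := by
  obtain ⟨q, hq⟩ := CharP.exists R
  have h1 : q ∣ p := (CharP.cast_eq_zero_iff R q p).1 h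
  rcases (Nat.dvd_prime Fact.out).1 h1 with rfl | rfl
  · exact absurd rfl (CharP.char_ne_one R 1)
  · exact hq

instance monoidAlgebra_charP (X : Type*) [Monoid X] : CharP (MonoidAlgebra (ZMod p) X) p := by
  have : Nontrivial (MonoidAlgebra (ZMod p) X) := MonoidAlgebra.instNontrivial
  refine charP_of_natCast_eq_zero ?_
  rw [MonoidAlgebra.natCast_def, CharP.cast_eq_zero, MonoidAlgebra.single_zero]

instance smallAlgebra_nontrivial : Nontrivial (SmallAlgebra p G) := (eps p G).domain_nontrivial

instance smallAlgebra_charP : CharP (SmallAlgebra p G) p := by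
  refine charP_of_natCast_eq_zero ?_
  have h : (p : MonoidAlgebra (ZMod p) G) = 0 := CharP.cast_eq_zero _ _
  have h2 := congrArg (Ideal.Quotient.mk (smallIdeal p G)) h
  rwa [map_natCast, map_zero] at h2

/-- Frobenius is additive and fixes the coefficients in the prime field. -/
theorem pow_pow_eq_mapDomain {A : Type*} [CommGroup A] (x : MonoidAlgebra (ZMod p) A) (e : ℕ) :
    x ^ p ^ e = MonoidAlgebra.mapDomainRingHom (ZMod p) (powMonoidHom (p ^ e)) x := by
  induction x using MonoidAlgebra.induction_linear with
  | zero => simp [(Fact.out : p.Prime).ne_zero]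
  | add a b ha hb => rw [add_pow_char_pow, ha, hb, map_add]
  | single g c => simp [MonoidAlgebra.single_pow, ZMod.pow_card_pow]

theorem gam_antitone : Antitone (gam G) := fun _ _ h =>
  Subgroup.lowerCentralSeries_antitone _ (Nat.sub_le_sub_right h 1)

theorem commutator_mem_gam_succ {i : ℕ} (hi : 1 ≤ i) {n : G} (hn : n ∈ gam G i) (g : G) :
    ⁅n, g⁆ ∈ gam G (i + 1) := by
  obtain ⟨j, rfl⟩ := Nat.exists_eq_add_of_le' hi
  exact Subgroup.commutator_mem_commutator hn (Subgroup.mem_top g)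

theorem proj_commutator (x y : SmallAlgebra p G) : proj p G (x * y - y * x) = 0 := by
  rw [map_sub, map_mul, map_mul, mul_comm, sub_self]

theorem mul_mem_subOne {i : ℕ} (hi : 2 ≤ i) {j x : SmallAlgebra p G}
    (hj : j ∈ subOne p (gam G i) (gam_antitone hi)) (hx : eps p G x = 0) :
    j * x ∈ subOne p (gam G (i + 1)) (gam_antitone (hi.trans i.le_succ)) := by
  obtain ⟨n, hn, rfl⟩ := hj
  refine mem_of_eps_eq_zero
    ((subOne p (gam G (i + 1)) (gam_antitone (hi.trans i.le_succ))).comap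
      (AddMonoidHom.mulLeft (emb p G n - 1))) (fun g => ?_) x hx
  rw [AddSubgroup.mem_comap, AddMonoidHom.coe_mulLeft,
    emb_sub_one_mul_emb_sub_one g (gam_antitone hi hn)]
  exact ⟨_, commutator_mem_gam_succ (by lia) (inv_mem hn) _, rfl⟩

theorem mem_subOne_three_mul (h4 : gam G 4 = ⊥) {j x : SmallAlgebra p G}
    (hj : j ∈ subOne p (gam G 3) (gam_antitone (by lia))) (hx : eps p G x = 0) : j * x = 0 := by
  obtain ⟨n, hn, h⟩ := mul_mem_subOne (by lia) hj hx
  rw [h4, Subgroup.mem_bot] at hn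
  rw [← h, hn, map_one, sub_self]

variable (p G) in
/-- The augmentation ideal of the small group algebra. -/
noncomputable abbrev ker : Ideal (SmallAlgebra p G) := RingHom.ker (eps p G)

/-- In [ab, x] = a[b, x] + [a, x]b the first term lies in IJ = 0 and the second in JI, that is, in
γ_3 - 1. -/
theorem lie_sq_mem (x : SmallAlgebra p G) {v : SmallAlgebra p G} (hv : v ∈ ker p G * ker p G) :
    v * x - x * v ∈ subOne p (gam G 3) (gam_antitone (by lia)) := by
  refine Submodule.mul_induction_on hv ?_ ?_
  · intro a ha b hb
    have h1 : a * (b * x - x * b) = 0 :=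
      mul_eq_zero_of_eps_of_proj ha (proj_commutator b x)
    have h2 : a * b * x - x * (a * b) = a * (b * x - x * b) + (a * x - x * a) * b := by
      noncomm_ring
    rw [h2, h1, zero_add]
    exact mul_mem_subOne le_rfl (proj_eq_zero_iff.1 (proj_commutator a x)) hb
  · intro a b ha hb
    have : (a + b) * x - x * (a + b) = (a * x - x * a) + (b * x - x * b) := by noncomm_ring
    rw [this]
    exact add_mem ha hb

theorem mul_sq_eq_zero (h4 : gam G 4 = ⊥) {j v : SmallAlgebra p G} (hj : proj p G j = 0)
    (hv : v ∈ ker p G * ker p G) : j * v = 0 := by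
  refine Submodule.mul_induction_on hv ?_ ?_
  · intro a ha b hb
    rw [← mul_assoc]
    exact mem_subOne_three_mul h4 (mul_mem_subOne le_rfl (proj_eq_zero_iff.1 hj) ha) hb
  · intro a b ha hb
    rw [mul_add, ha, hb, add_zero]

/-- For v = ab one has [v, w] = a[b, w] - [w, a]b. Here a[b, w] ∈ IJ = 0, and [w, a] ∈ γ_3 - 1 is
killed by b because γ_4 = 1. -/
theorem sq_mul_comm (h4 : gam G 4 = ⊥) {v w : SmallAlgebra p G} (hv : v ∈ ker p G * ker p G)
    (hw : w ∈ ker p G * ker p G) : v * w = w * v := by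
  refine Submodule.mul_induction_on hv ?_ ?_
  · intro a ha b hb
    have h1 : a * (b * w - w * b) = 0 :=
      mul_eq_zero_of_eps_of_proj ha (proj_commutator b w)
    have h2 : (w * a - a * w) * b = 0 := by
      refine mem_subOne_three_mul h4 (lie_sq_mem a hw) hb
    have h3 : a * b * w - w * (a * b) = a * (b * w - w * b) - (w * a - a * w) * b := by
      noncomm_ring
    rw [h1, h2, sub_zero] at h3
    exact sub_eq_zero.1 h3
  · intro a b ha hb
    rw [mul_add, add_mul, ha, hb]

/-- In a power of ab the factors may be sorted: the commutators that arise lie in J and have a power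
of a on their left. -/
theorem mul_pow_of_eps_eq_zero {a : SmallAlgebra p G} (b : SmallAlgebra p G)
    (ha : eps p G a = 0) (m : ℕ) : (a * b) ^ m = a ^ m * b ^ m := by
  induction m with
  | zero => simp
  | succ m ih =>
    rcases Nat.eq_zero_or_pos m with rfl | hm
    · simp
    have h1 : a ^ m * (b ^ m * a - a * b ^ m) = 0 :=
      mul_eq_zero_of_eps_of_proj (by rw [map_pow, ha, zero_pow hm.ne']) (proj_commutator _ _)
    rw [mul_sub, sub_eq_zero] at h1
    calc (a * b) ^ (m + 1) = a ^ m * (b ^ m * a) * b := by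
          rw [pow_succ, ih]; simp only [mul_assoc]
      _ = a ^ (m + 1) * b ^ (m + 1) := by
          rw [h1, pow_succ, pow_succ]; simp only [mul_assoc]

variable (p G) in
/-- The elements whose `p ^ e`-th power vanishes modulo the kernel of `proj`. -/
noncomputable def frobKer (e : ℕ) : Ideal (SmallAlgebra p G) :=
  RingHom.ker ((iterateFrobenius (MonoidAlgebra (ZMod p) (Abelianization G)) p e).comp (proj p G))

theorem mem_frobKer {e : ℕ} {x : SmallAlgebra p G} :
    x ∈ frobKer p G e ↔ proj p G x ^ p ^ e = 0 := by
  rw [frobKer, RingHom.mem_ker, RingHom.comp_apply, iterateFrobenius_def]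

theorem frobKer_le_ker (e : ℕ) : frobKer p G e ≤ ker p G := by
  intro x hx
  have h := congrArg (aug p _) (mem_frobKer.1 hx)
  rw [map_pow, map_zero, aug_proj] at h
  exact (pow_eq_zero_iff (pow_ne_zero _ (Fact.out : p.Prime).ne_zero)).1 h

/-- For a single product, (ab)^(p^e) = a^(p^e) b^(p^e) ∈ IJ = 0. Sums reduce to this case because
elements of I² commute. -/
theorem pow_eq_zero_of_mem_mul_frobKer (h4 : gam G 4 = ⊥) {e : ℕ}
    {v : SmallAlgebra p G} (hv : v ∈ ker p G * frobKer p G e) : v ^ p ^ e = 0 := by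
  have hle : ker p G * frobKer p G e ≤ ker p G * ker p G :=
    Ideal.mul_mono_right (frobKer_le_ker e)
  have hp : p ^ e ≠ 0 := pow_ne_zero _ (Fact.out : p.Prime).ne_zero
  refine (Submodule.mul_induction_on (C := fun v => v ∈ ker p G * frobKer p G e ∧ v ^ p ^ e = 0)
    hv ?_ ?_).2
  · intro a ha b hb
    refine ⟨Ideal.mul_mem_mul ha hb, ?_⟩
    rw [mul_pow_of_eps_eq_zero b ha]
    refine mul_eq_zero_of_eps_of_proj ?_ ?_
    · rw [map_pow, RingHom.mem_ker.1 ha, zero_pow hp]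
    · rw [map_pow]; exact mem_frobKer.1 hb
  · rintro a b ⟨ha, ha'⟩ ⟨hb, hb'⟩
    refine ⟨add_mem ha hb, ?_⟩
    rw [add_pow_char_pow_of_commute (p := p) (h := sq_mul_comm h4 (hle ha) (hle hb)), ha', hb',
      add_zero]

/-- The elements that agree with `y - 1`, for some `y` with `y ^ p ^ e ∈ γ_2(G)`, modulo
`I · frobKer e`. -/
noncomputable def embModFrobKer (p : ℕ) [Fact p.Prime] (G : Type u) [Group G] (e : ℕ) :
    AddSubgroup (SmallAlgebra p G) where
  carrier := {x | ∃ y : G, emb p G y - 1 ∈ frobKer p G e ∧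
    x - (emb p G y - 1) ∈ ker p G * frobKer p G e}
  zero_mem' := ⟨1, by simp, by simp⟩
  add_mem' := by
    rintro a b ⟨y, hy, hay⟩ ⟨z, hz, hbz⟩
    have h1 : emb p G (y * z) - 1 = emb p G y * (emb p G z - 1) + (emb p G y - 1) := by
      rw [map_mul]; noncomm_ring
    refine ⟨y * z, ?_, ?_⟩
    · rw [h1]
      exact add_mem (Ideal.mul_mem_left _ _ hz) hy
    · have h2 : a + b - (emb p G (y * z) - 1) = (a - (emb p G y - 1)) + (b - (emb p G z - 1)) -
          (emb p G y - 1) * (emb p G z - 1) := by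
        rw [map_mul]; noncomm_ring
      rw [h2]
      exact sub_mem (add_mem hay hbz) (Ideal.mul_mem_mul (frobKer_le_ker e hy) hz)
  neg_mem' := by
    rintro a ⟨y, hy, hay⟩
    have h0 : emb p G y⁻¹ * emb p G y = 1 := by rw [← map_mul, inv_mul_cancel, map_one]
    have h1 : emb p G y⁻¹ - 1 = -(emb p G y⁻¹ * (emb p G y - 1)) := by
      rw [mul_sub, h0]; noncomm_ring
    have h3 : emb p G y⁻¹ - 1 ∈ frobKer p G e := by
      rw [h1]
      exact neg_mem (Ideal.mul_mem_left _ _ hy)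
    refine ⟨y⁻¹, h3, ?_⟩
    have h2 : -a - (emb p G y⁻¹ - 1) = -(a - (emb p G y - 1)) +
        (emb p G y⁻¹ - 1) * (emb p G y - 1) := by
      rw [sub_mul, mul_sub, h0]; noncomm_ring
    rw [h2]
    exact add_mem (neg_mem hay) (Ideal.mul_mem_mul (frobKer_le_ker e h3) hy)

/-- Additively, `frobKer` is generated by the elements c(gn - g) with n^(p^e) ∈ γ_2. Modulo I ·
`frobKer`, gn - g is n - 1, and n ↦ n - 1 is additive on such n. -/
theorem frobKer_le_embModFrobKer (e : ℕ) {x : SmallAlgebra p G} (hx : x ∈ frobKer p G e) :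
    x ∈ embModFrobKer p G e := by
  obtain ⟨x, rfl⟩ := Ideal.Quotient.mk_surjective x
  refine mem_of_mapDomainRingHom_eq_zero ((powMonoidHom (p ^ e)).comp Abelianization.of)
      ((embModFrobKer p G e).comap
        (Ideal.Quotient.mk (smallIdeal p G) : _ →+* _).toAddMonoidHom) ?_ x ?_
  · intro g n hn c
    change Ideal.Quotient.mk (smallIdeal p G) _ ∈ embModFrobKer p G e
    rw [map_sub, mk_single, mk_single, ← smul_sub]
    have h1 : emb p G n - 1 ∈ frobKer p G e := by
      rw [mem_frobKer, pow_pow_eq_mapDomain, map_sub, map_sub, proj_emb]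
      have : Abelianization.of n ^ p ^ e = 1 := hn
      simp [this, MonoidAlgebra.one_def]
    have h2 : emb p G (g * n) - emb p G g - (emb p G n - 1) =
        (emb p G g - 1) * (emb p G n - 1) := by
      rw [map_mul]; noncomm_ring
    have h3 : emb p G (g * n) - emb p G g ∈ embModFrobKer p G e := ⟨n, h1, by
      rw [h2]
      exact Ideal.mul_mem_mul (by rw [RingHom.mem_ker, map_sub, eps_emb, map_one, sub_self]) h1⟩
    exact nsmul_mem h3 _
  · rw [mem_frobKer, pow_pow_eq_mapDomain, proj_mk] at hx
    rw [MonoidAlgebra.mapDomainRingHom_comp]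
    exact hx

theorem exists_emb_inv_mul_sub_one_mem (e : ℕ) {u : SmallAlgebra p G}
    (hu : proj p G u ^ p ^ e = 1) :
    ∃ y : G, emb p G y⁻¹ * u - 1 ∈ ker p G * frobKer p G e := by
  obtain ⟨y, -, hy⟩ := frobKer_le_embModFrobKer e (x := u - 1) (by
    rw [mem_frobKer, map_sub, map_one, sub_pow_char_pow, hu, one_pow, sub_self])
  refine ⟨y, ?_⟩
  have h0 : emb p G y⁻¹ * emb p G y = 1 := by rw [← map_mul, inv_mul_cancel, map_one]
  have : emb p G y⁻¹ * u - 1 = emb p G y⁻¹ * (u - 1 - (emb p G y - 1)) := by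
    rw [sub_sub_sub_cancel_right, mul_sub, h0]
  rw [this]
  exact Ideal.mul_mem_left _ _ hy

end RingStructure

/-- If `⁅w, y⁆` is central, `(y w) ^ m = y ^ m w ^ m ⁅w, y⁆ ^ (m choose 2)`. -/
theorem mul_pow_of_commutator_central {X : Type*} [Group X] {y w c : X} (hc : w * y = y * w * c)
    (hcy : c * y = y * c) (hcw : c * w = w * c) (m : ℕ) :
    (y * w) ^ m = y ^ m * w ^ m * c ^ m.choose 2 := by
  have h1 : ∀ m : ℕ, w ^ m * y = y * w ^ m * c ^ m := by
    intro m
    induction m with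
    | zero => simp
    | succ m ih =>
      have e : c ^ m * w = w * c ^ m := (Commute.pow_left hcw m : Commute (c ^ m) w)
      have e1 : w * w ^ m * y = y * w * w ^ m * (c * c ^ m) := by
        have e2 : c * w ^ m = w ^ m * c := (Commute.pow_right hcw m : Commute c (w ^ m))
        calc w * w ^ m * y = w * (w ^ m * y) := by group
          _ = (w * y) * w ^ m * c ^ m := by rw [ih]; group
          _ = y * w * (c * w ^ m) * c ^ m := by rw [hc]; group
          _ = _ := by rw [e2]; group
      rw [pow_succ' w, pow_succ' c, e1]; group
  induction m with
  | zero => simp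
  | succ m ih =>
    have e2 : c ^ m.choose 2 * y = y * c ^ m.choose 2 :=
      (Commute.pow_left hcy _ : Commute (c ^ m.choose 2) y)
    have e3 : c ^ m.choose 2 * w = w * c ^ m.choose 2 :=
      (Commute.pow_left hcw _ : Commute (c ^ m.choose 2) w)
    have e4 : c ^ m * w = w * c ^ m := (Commute.pow_left hcw m : Commute (c ^ m) w)
    calc (y * w) ^ (m + 1) = y ^ m * w ^ m * (c ^ m.choose 2 * y) * w := by
          rw [pow_succ, ih]; group
      _ = y ^ m * (w ^ m * y) * (c ^ m.choose 2 * w) := by rw [e2]; group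
      _ = y ^ m * y * w ^ m * (c ^ m * w) * c ^ m.choose 2 := by rw [h1, e3]; group
      _ = (y ^ m * y) * (w ^ m * w) * (c ^ m * c ^ m.choose 2) := by rw [e4]; group
      _ = _ := by
          rw [← pow_succ, ← pow_succ, ← pow_add, Nat.choose_succ_succ' m 1, Nat.choose_one_right]

/-- The oddness of p enters here: it kills the commutator factor in `mul_pow_prime_pow`. -/
theorem dvd_choose_two {p e : ℕ} (hp : p.Prime) (hp2 : p ≠ 2) (he : 1 ≤ e) :
    p ∣ (p ^ e).choose 2 := by
  rw [Nat.choose_two_right]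
  have h1 : p ∣ p ^ e * (p ^ e - 1) := dvd_mul_of_dvd_left (dvd_pow_self p (by lia)) _
  have h2 : 2 ∣ p ^ e * (p ^ e - 1) := (Nat.even_mul_pred_self _).two_dvd
  have h3 : Nat.Coprime 2 p := (Nat.coprime_primes Nat.prime_two hp).2 (Ne.symm hp2)
  exact Nat.dvd_div_of_mul_dvd (Nat.Coprime.mul_dvd_of_dvd_of_dvd h3 h2 h1)

theorem mul_pow_prime_pow {X : Type*} [Group X] {p e : ℕ} (hp : p.Prime) (hp2 : p ≠ 2)
    (he : 1 ≤ e) {y w : X} (hcy : ⁅w⁻¹, y⁻¹⁆ * y = y * ⁅w⁻¹, y⁻¹⁆)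
    (hcw : ⁅w⁻¹, y⁻¹⁆ * w = w * ⁅w⁻¹, y⁻¹⁆) (hc : ⁅w⁻¹, y⁻¹⁆ ^ p = 1) :
    (y * w) ^ p ^ e = y ^ p ^ e * w ^ p ^ e := by
  have h : w * y = y * w * ⁅w⁻¹, y⁻¹⁆ := by simp [commutatorElement_def, mul_assoc]
  rw [mul_pow_of_commutator_central h hcy hcw]
  obtain ⟨k, hk⟩ := dvd_choose_two hp hp2 he
  rw [hk, pow_mul, hc, one_pow, mul_one]

/-! ### The normalized units and their lower central series -/

section Units

variable {p : ℕ} [Fact p.Prime] {G : Type u} [Group G]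

theorem emb_pow_prime {n : G} (hn : n ∈ gam G 2) : emb p G (n ^ p) = 1 := by
  have h1 : (emb p G n - 1) ^ 2 = 0 := by
    rw [sq]
    exact mul_emb_sub_one (by rw [map_sub, eps_emb, map_one, sub_self]) hn
  have h2 : (emb p G n - 1) ^ p = 0 := pow_eq_zero_of_le (Fact.out : p.Prime).two_le h1
  rw [map_pow, ← sub_eq_zero, ← h2, sub_pow_char_of_commute p (h := Commute.one_right _), one_pow]

/-- If p^k annihilates G/γ_2, then x^(p^k) ∈ J, and J² ⊆ IJ = 0. -/
theorem isNilpotent_of_eps_eq_zero [Finite G] (hG : IsPGroup p G) {x : SmallAlgebra p G}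
    (hx : eps p G x = 0) : IsNilpotent x := by
  have hA : IsPGroup p (Abelianization G) :=
    hG.of_surjective Abelianization.of QuotientGroup.mk_surjective
  obtain ⟨k, hk⟩ := isPGroup_iff_exists_pow_pow_eq_one.1 hA
  have h1 : proj p G (x ^ p ^ k) = 0 := by
    have h : ∀ y : MonoidAlgebra (ZMod p) (Abelianization G),
        MonoidAlgebra.mapDomainRingHom (ZMod p) (powMonoidHom (p ^ k)) y =
          MonoidAlgebra.single 1 (aug p _ y) := by
      intro y
      induction y using MonoidAlgebra.induction_linear with
      | zero => simp
      | add a b ha hb => simp only [map_add, ha, hb, MonoidAlgebra.single_add]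
      | single g c => simp [aug_single, hk]
    rw [map_pow, pow_pow_eq_mapDomain, h, aug_proj, hx, MonoidAlgebra.single_zero]
  refine ⟨p ^ k * 2, ?_⟩
  rw [pow_mul, sq]
  exact mul_eq_zero_of_eps_of_proj (eps_eq_zero_of_proj_eq_zero h1) h1

theorem mem_jacobson_iff [Finite G] (hG : IsPGroup p G) (x : SmallAlgebra p G) :
    x ∈ Ring.jacobson (SmallAlgebra p G) ↔ eps p G x = 0 := by
  rw [← Ideal.jacobson_bot, Ideal.mem_jacobson_iff]
  constructor
  · intro h
    by_contra hx
    -- With y of augmentation -1/ε(x), the element zyx + z - 1 has augmentation -1, so it cannot be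
    -- 0.
    obtain ⟨z, hz⟩ := h (-(((eps p G x)⁻¹.val : ℕ) : SmallAlgebra p G))
    have h2 := congrArg (eps p G) (Ideal.mem_bot.1 hz)
    rw [map_sub, map_add, map_mul, map_mul, map_neg, map_natCast, ZMod.natCast_zmod_val, map_zero,
      map_one, mul_assoc, neg_mul, inv_mul_cancel₀ hx] at h2
    simp at h2
  · intro hx y
    have hn : IsNilpotent (y * x) :=
      isNilpotent_of_eps_eq_zero hG (by rw [map_mul, hx, mul_zero])
    obtain ⟨u, hu⟩ := hn.isUnit_one_add
    refine ⟨((u⁻¹ : _ˣ) : SmallAlgebra p G), ?_⟩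
    have h := u.inv_mul
    rw [hu, mul_add, mul_one] at h
    rw [Ideal.mem_bot, mul_assoc, add_comm, h, sub_self]

theorem mem_normalizedUnits_iff [Finite G] (hG : IsPGroup p G) (u : (SmallAlgebra p G)ˣ) :
    u ∈ normalizedUnits (SmallAlgebra p G) ↔ eps p G u = 1 := by
  change (u : SmallAlgebra p G) - 1 ∈ Ring.jacobson (SmallAlgebra p G) ↔ _
  rw [mem_jacobson_iff hG, map_sub, map_one, sub_eq_zero]

variable (p G) in
/-- The inclusion of the group of normalized units in the algebra. -/
noncomputable def val : SmallUnits p G →* SmallAlgebra p G :=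
  (Units.coeHom _).comp (Subgroup.subtype _)

theorem val_injective : Function.Injective (val p G) :=
  Units.val_injective.comp Subtype.val_injective

theorem exists_val_eq [Finite G] (hG : IsPGroup p G) {x : SmallAlgebra p G}
    (hx : eps p G x = 1) : ∃ u : SmallUnits p G, val p G u = x := by
  have hn : IsNilpotent (x - 1) :=
    isNilpotent_of_eps_eq_zero hG (by rw [map_sub, hx, map_one, sub_self])
  obtain ⟨u, hu⟩ := hn.isUnit_one_add
  rw [add_sub_cancel] at hu
  exact ⟨⟨u, (mem_normalizedUnits_iff hG u).2 (by rw [hu, hx])⟩, hu⟩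

/-- The natural map from `G` to the normalized units of its small group algebra. -/
noncomputable def embS [Finite G] (hG : IsPGroup p G) : G →* SmallUnits p G :=
  (MonoidHom.toHomUnits (emb p G)).codRestrict _ fun g =>
    (mem_normalizedUnits_iff hG _).2 (eps_emb p G g)

theorem val_embS [Finite G] (hG : IsPGroup p G) (g : G) : val p G (embS hG g) = emb p G g := rfl

variable [Finite G] (hG : IsPGroup p G)
include hG

theorem eps_val (u : SmallUnits p G) : eps p G (val p G u) = 1 :=
  (mem_normalizedUnits_iff hG u).1 u.2

theorem eps_val_sub_one (u : SmallUnits p G) : eps p G (val p G u - 1) = 0 := by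
  rw [map_sub, eps_val hG, map_one, sub_self]

theorem mem_map_embS_iff {M : Subgroup G} (hM : M ≤ gam G 2) {u : SmallUnits p G} :
    u ∈ M.map (embS hG) ↔ val p G u - 1 ∈ subOne p M hM := by
  constructor
  · rintro ⟨m, hm, rfl⟩
    exact ⟨m, hm, rfl⟩
  · rintro ⟨m, hm, h⟩
    exact ⟨m, hm, val_injective (sub_left_injective h)⟩

theorem map_embS_gam_le (i : ℕ) : (gam G i).map (embS hG) ≤ gam (SmallUnits p G) i := by
  unfold gam
  rw [Subgroup.map_lowerCentralSeries]
  exact Subgroup.lowerCentralSeries_mono (i - 1) le_top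

/-- The target of `proj` is commutative, and conversely 1 + J is the image of γ_2(G). -/
theorem mem_gam_two_iff {u : SmallUnits p G} :
    u ∈ gam (SmallUnits p G) 2 ↔ proj p G (val p G u) = 1 := by
  constructor
  · intro h
    let φ : SmallUnits p G →* (MonoidAlgebra (ZMod p) (Abelianization G))ˣ :=
      MonoidHom.toHomUnits ((proj p G : SmallAlgebra p G →* _).comp (val p G))
    have h1 := Abelianization.commutator_subset_ker φ h
    exact congrArg Units.val h1
  · intro h
    refine map_embS_gam_le hG 2 ((mem_map_embS_iff hG le_rfl).2 (proj_eq_zero_iff.1 ?_))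
    rw [map_sub, h, map_one, sub_self]

theorem gam_two_eq : gam (SmallUnits p G) 2 = (gam G 2).map (embS hG) := by
  ext u
  rw [mem_gam_two_iff hG, mem_map_embS_iff hG le_rfl, ← proj_eq_zero_iff, map_sub, map_one,
    sub_eq_zero]

/-- [u, v] - 1 = (uv - vu)(vu)⁻¹, and right multiplication by a unit of augmentation 1 changes an
element of γ_i - 1 only by an element of γ_(i+1) - 1. -/
theorem commutator_mem_of_lie_mem {i : ℕ} (hi : 2 ≤ i) {u v : SmallUnits p G}
    (h : val p G u * val p G v - val p G v * val p G u ∈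
      subOne p (gam G i) (gam_antitone hi)) :
    ⁅u, v⁆ ∈ (gam G i).map (embS hG) := by
  rw [mem_map_embS_iff hG (gam_antitone hi)]
  have h1 : val p G ⁅u, v⁆ - 1 = (val p G u * val p G v - val p G v * val p G u) *
      val p G (u⁻¹ * v⁻¹) := by
    rw [sub_mul, ← map_mul, ← map_mul, ← map_mul, ← map_mul, commutatorElement_def]
    congr 1
    · congr 1; group
    · rw [← map_one (val p G)]; congr 1; group
  have h2 := mul_mem_subOne hi h (eps_val_sub_one hG (u⁻¹ * v⁻¹))
  rw [h1, ← add_sub_cancel 1 (val p G (u⁻¹ * v⁻¹)), mul_add, mul_one]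
  refine add_mem h ?_
  obtain ⟨n, hn, hn'⟩ := h2
  exact ⟨n, gam_antitone (Nat.le_succ i) hn, hn'⟩

theorem lie_val_embS_mem {i : ℕ} (hi : 2 ≤ i) {n : G} (hn : n ∈ gam G i) (v : SmallUnits p G) :
    val p G (embS hG n) * val p G v - val p G v * val p G (embS hG n) ∈
      subOne p (gam G (i + 1)) (gam_antitone (hi.trans i.le_succ)) := by
  have h1 := mul_mem_subOne hi (mem_subOne.2 ⟨n, hn, rfl⟩) (eps_val_sub_one hG v)
  have h2 := mul_emb_sub_one (eps_val_sub_one hG v) (gam_antitone hi hn)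
  have h3 : val p G (embS hG n) * val p G v - val p G v * val p G (embS hG n) =
      (emb p G n - 1) * (val p G v - 1) - (val p G v - 1) * (emb p G n - 1) := by
    rw [val_embS]; noncomm_ring
  rw [h3, h2, sub_zero]
  exact h1

theorem gam_succ_eq {i : ℕ} (hi : 2 ≤ i)
    (h : gam (SmallUnits p G) i = (gam G i).map (embS hG)) :
    gam (SmallUnits p G) (i + 1) = (gam G (i + 1)).map (embS hG) := by
  refine le_antisymm ?_ (map_embS_gam_le hG (i + 1))
  obtain ⟨j, rfl⟩ := Nat.exists_eq_add_of_le' (show 1 ≤ i by lia)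
  change ⁅gam (SmallUnits p G) (j + 1), ⊤⁆ ≤ _
  rw [h, Subgroup.commutator_le]
  rintro _ ⟨n, hn, rfl⟩ v -
  exact commutator_mem_of_lie_mem hG (by lia) (lie_val_embS_mem hG hi hn v)

theorem gam_three_eq : gam (SmallUnits p G) 3 = (gam G 3).map (embS hG) :=
  gam_succ_eq hG le_rfl (gam_two_eq hG)

theorem gam_four_eq : gam (SmallUnits p G) 4 = (gam G 4).map (embS hG) :=
  gam_succ_eq hG (by lia) (gam_three_eq hG)

theorem commutator_mem_gam_three {w : SmallUnits p G} (hw : val p G w - 1 ∈ ker p G * ker p G)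
    (s : SmallUnits p G) : ⁅w, s⁆ ∈ gam (SmallUnits p G) 3 := by
  rw [gam_three_eq hG]
  refine commutator_mem_of_lie_mem hG (by lia) ?_
  have h := lie_sq_mem (val p G s) hw
  have e : (val p G w - 1) * val p G s - val p G s * (val p G w - 1) =
    val p G w * val p G s - val p G s * val p G w := by noncomm_ring
  rwa [e] at h

/-- Both products of n - 1 and w - 1 vanish: one lies in IJ = 0, the other in JI² ⊆ γ_4 - 1 = 0. -/
theorem commute_embS (h4 : gam G 4 = ⊥) {w : SmallUnits p G}
    (hw : val p G w - 1 ∈ ker p G * ker p G) {n : G} (hn : n ∈ gam G 2) :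
    Commute w (embS hG n) := by
  refine val_injective ?_
  rw [map_mul, map_mul, val_embS]
  have h1 := mul_sq_eq_zero h4 (proj_eq_zero_iff.2 ⟨n, hn, rfl⟩) hw
  have h2 := mul_emb_sub_one (eps_val_sub_one hG w) hn
  have h3 : val p G w * emb p G n - emb p G n * val p G w =
      (val p G w - 1) * (emb p G n - 1) - (emb p G n - 1) * (val p G w - 1) := by noncomm_ring
  rw [h1, h2, sub_zero] at h3
  exact sub_eq_zero.1 h3

/-- A unit whose `p ^ e`-th power lies in the derived subgroup agrees with an element of `G` up to
a factor that is central modulo `γ_3` and has trivial `p ^ e`-th power. -/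
theorem exists_eq_embS_mul (hp2 : p ≠ 2) (h4 : gam G 4 = ⊥) {e : ℕ} (he : 1 ≤ e)
    {u : SmallUnits p G} (hu : u ^ p ^ e ∈ gam (SmallUnits p G) 2) :
    ∃ (y : G) (w : SmallUnits p G), u = embS hG y * w ∧ val p G w - 1 ∈ ker p G * ker p G ∧
      u ^ p ^ e = embS hG (y ^ p ^ e) := by
  have hle : ker p G * frobKer p G e ≤ ker p G * ker p G :=
    Ideal.mul_mono_right (frobKer_le_ker e)
  rw [mem_gam_two_iff hG, map_pow, map_pow] at hu
  obtain ⟨y, hy⟩ := exists_emb_inv_mul_sub_one_mem e hu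
  have hval : val p G ((embS hG y)⁻¹ * u) = emb p G y⁻¹ * val p G u := by
    rw [map_mul, ← map_inv, val_embS]
  set w := (embS hG y)⁻¹ * u with hw
  rw [← hval] at hy
  have huw : u = embS hG y * w := by rw [hw]; group
  -- In characteristic p, w^(p^e) - 1 = (w - 1)^(p^e), and w - 1 ∈ I · `frobKer`.
  have hwp : w ^ p ^ e = 1 := by
    refine val_injective ?_
    have h := pow_eq_zero_of_mem_mul_frobKer h4 hy
    rw [sub_pow_char_pow_of_commute p e (h := Commute.one_right _), one_pow, sub_eq_zero] at h
    rw [map_pow, h, map_one]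
  refine ⟨y, w, huw, hle hy, ?_⟩
  -- This commutator is central because γ_4(S) = 1, and has exponent p, so (yw)^(p^e) = y^(p^e)
  -- w^(p^e).
  have hcomm : ⁅w⁻¹, (embS hG y)⁻¹⁆ ∈ gam (SmallUnits p G) 3 := by
    have h := (Subgroup.upperCentralSeriesStep (gam (SmallUnits p G) 3)).inv_mem
      (x := w) (commutator_mem_gam_three hG (hle hy))
    exact h _
  have hcent : ∀ s, ⁅w⁻¹, (embS hG y)⁻¹⁆ * s = s * ⁅w⁻¹, (embS hG y)⁻¹⁆ := by
    intro s
    have h := commutator_mem_gam_succ (by lia) hcomm s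
    rw [gam_four_eq hG, h4, Subgroup.map_bot, Subgroup.mem_bot] at h
    exact commutatorElement_eq_one_iff_mul_comm.1 h
  rw [huw, mul_pow_prime_pow Fact.out hp2 he (hcent _) (hcent _) ?_, hwp, mul_one, map_pow]
  rw [gam_three_eq hG] at hcomm
  obtain ⟨n, hn, hn'⟩ := hcomm
  rw [← hn', ← map_pow]
  exact val_injective (emb_pow_prime (gam_antitone (by lia) hn))

theorem embS_injective (hinj : ∀ n ∈ gam G 2, embS hG n = 1 → n = 1) :
    Function.Injective (embS hG) := by
  refine (injective_iff_map_eq_one _).2 fun g hg => hinj g ?_ hg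
  have h1 : proj p G (emb p G g) = 1 := by
    rw [← val_embS hG, hg, map_one, map_one]
  rw [proj_emb, MonoidAlgebra.one_def, MonoidAlgebra.single_left_inj one_ne_zero] at h1
  exact (of_eq_one_iff G g).1 h1

end Units

theorem map_gam_of_surjective {X Y : Type*} [Group X] [Group Y] {f : X →* Y}
    (hf : Function.Surjective f) (i : ℕ) : (gam X i).map f = gam Y i := by
  unfold gam
  rw [Subgroup.map_lowerCentralSeries, Subgroup.map_top_of_surjective f hf]

theorem mulEquiv_mem_gam_iff {X Y : Type*} [Group X] [Group Y] (f : X ≃* Y) (i : ℕ) (x : X) :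
    f x ∈ gam Y i ↔ x ∈ gam X i := by
  rw [← map_gam_of_surjective (f := f.toMonoidHom) f.surjective i]
  exact Subgroup.mem_map_iff_mem f.injective

/-! ### Orders determined by the unit group -/

section Counting

variable {p : ℕ} [Fact p.Prime]

theorem card_monoidAlgebra (X : Type*) [Finite X] :
    Nat.card (MonoidAlgebra (ZMod p) X) = p ^ Nat.card X := by
  rw [Nat.card_congr (MonoidAlgebra.coeffEquiv.trans Finsupp.equivFunOnFinite), Nat.card_fun,
    Nat.card_zmod]

theorem finite_monoidAlgebra (X : Type*) [Finite X] : Finite (MonoidAlgebra (ZMod p) X) :=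
  Finite.of_equiv _ (MonoidAlgebra.coeffEquiv.trans Finsupp.equivFunOnFinite).symm

theorem card_range_mapDomainRingHom {X Y : Type*} [Group X] [Group Y] [Finite X]
    (f : X →* Y) :
    Nat.card (MonoidAlgebra.mapDomainRingHom (ZMod p) f).toAddMonoidHom.range =
      p ^ Nat.card f.range := by
  have hinj : Function.Injective
      (MonoidAlgebra.mapDomainRingHom (ZMod p) f.range.subtype).toAddMonoidHom :=
    MonoidAlgebra.mapDomain_injective f.range.subtype_injective
  have hsurj : Function.Surjective
      (MonoidAlgebra.mapDomainRingHom (ZMod p) f.rangeRestrict).toAddMonoidHom := by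
    intro y
    induction y using MonoidAlgebra.induction_linear with
    | zero => exact ⟨0, map_zero _⟩
    | add a b ha hb =>
      obtain ⟨a, rfl⟩ := ha
      obtain ⟨b, rfl⟩ := hb
      exact ⟨a + b, map_add _ _ _⟩
    | single g c =>
      obtain ⟨g, rfl⟩ := f.rangeRestrict_surjective g
      exact ⟨MonoidAlgebra.single g c, by simp⟩
  have h : (MonoidAlgebra.mapDomainRingHom (ZMod p) f).toAddMonoidHom =
      (MonoidAlgebra.mapDomainRingHom (ZMod p) f.range.subtype).toAddMonoidHom.comp
        (MonoidAlgebra.mapDomainRingHom (ZMod p) f.rangeRestrict).toAddMonoidHom := by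
    conv_lhs => rw [← f.subtype_comp_rangeRestrict]
    exact congrArg RingHom.toAddMonoidHom
      (MonoidAlgebra.mapDomainRingHom_comp f.range.subtype f.rangeRestrict)
  have : Finite f.range := Finite.of_surjective _ f.rangeRestrict_surjective
  rw [h, AddMonoidHom.range_comp, AddMonoidHom.range_eq_top.2 hsurj,
    ← AddMonoidHom.range_eq_map, ← card_monoidAlgebra (p := p) f.range]
  exact Nat.card_congr (AddMonoidHom.ofInjective hinj).toEquiv.symm

variable {G : Type u} [Group G] [Finite G] (hG : IsPGroup p G)
include hG

theorem card_val_sub_one_mem (K : AddSubgroup (SmallAlgebra p G))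
    (hK : ∀ x ∈ K, eps p G x = 0) :
    Nat.card {u : SmallUnits p G // val p G u - 1 ∈ K} = Nat.card K := by
  refine Nat.card_congr (Equiv.ofBijective
    (fun u : {u : SmallUnits p G // val p G u - 1 ∈ K} => (⟨val p G u - 1, u.2⟩ : K))
    ⟨?_, ?_⟩)
  · intro u v h
    exact Subtype.ext (val_injective (sub_left_injective (congrArg Subtype.val h)))
  · rintro ⟨x, hx⟩
    obtain ⟨u, hu⟩ := exists_val_eq hG (x := 1 + x) (by rw [map_add, hK x hx, map_one, add_zero])
    have hu' : val p G u - 1 = x := by rw [hu, add_sub_cancel_left]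
    exact ⟨⟨u, by rwa [hu']⟩, Subtype.ext hu'⟩

/-- The kernel of f lies in I, so adding 1 matches it with a set of units. -/
theorem card_smallAlgebra_eq (f : SmallAlgebra p G →+ MonoidAlgebra (ZMod p) (Abelianization G))
    (hf : ∀ x, f x = 0 → eps p G x = 0) :
    Nat.card (SmallAlgebra p G) =
      Nat.card {u : SmallUnits p G // f (val p G u - 1) = 0} * Nat.card f.range := by
  have h := card_val_sub_one_mem hG f.ker fun x hx => hf x hx
  have h2 := f.ker.card_mul_index
  rw [AddSubgroup.index_ker, ← h] at h2
  exact h2.symm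

theorem card_smallAlgebra : Nat.card (SmallAlgebra p G) = Nat.card (SmallUnits p G) * p := by
  have h := card_val_sub_one_mem hG (eps p G).toAddMonoidHom.ker fun x hx => hx
  have h2 := (eps p G).toAddMonoidHom.ker.card_mul_index
  have h3 : (eps p G).toAddMonoidHom.range = ⊤ := by
    refine AddMonoidHom.range_eq_top.2 fun c => ⟨(c.val : SmallAlgebra p G), ?_⟩
    simp
  rw [AddSubgroup.index_ker, ← h, h3, AddSubgroup.card_top, Nat.card_zmod] at h2
  rw [← h2]
  congr 1
  exact Nat.card_congr (Equiv.subtypeUnivEquiv fun u => eps_val_sub_one hG u)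

omit hG [Finite G] in
theorem range_proj : (proj p G).toAddMonoidHom.range = ⊤ :=
  AddMonoidHom.range_eq_top.2 proj_surjective

theorem card_smallAlgebra_eq_gam_two :
    Nat.card (SmallAlgebra p G) =
      Nat.card (gam (SmallUnits p G) 2) * p ^ Nat.card (Abelianization G) := by
  rw [card_smallAlgebra_eq hG (proj p G).toAddMonoidHom
    fun x hx => eps_eq_zero_of_proj_eq_zero hx,
    range_proj, AddSubgroup.card_top,
    card_monoidAlgebra]
  congr 1
  refine Nat.card_congr (Equiv.subtypeEquivRight fun u => ?_)
  rw [mem_gam_two_iff hG]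
  change proj p G _ = 0 ↔ _
  rw [map_sub, map_one, sub_eq_zero]

/-- The additive map used is x ↦ `proj` x ^ p, whose image is the group algebra of the p-th powers
in G/γ_2. -/
theorem card_smallAlgebra_eq_pow :
    Nat.card (SmallAlgebra p G) =
      Nat.card {u : SmallUnits p G // u ^ p ∈ gam (SmallUnits p G) 2} *
        p ^ Nat.card (powMonoidHom p : Abelianization G →* Abelianization G).range := by
  have hpow : ∀ x : MonoidAlgebra (ZMod p) (Abelianization G),
      MonoidAlgebra.mapDomainRingHom (ZMod p) (powMonoidHom p) x = x ^ p := by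
    intro x
    have := pow_pow_eq_mapDomain x 1
    rw [pow_one] at this
    exact this.symm
  rw [card_smallAlgebra_eq hG ((MonoidAlgebra.mapDomainRingHom (ZMod p)
    (powMonoidHom p : Abelianization G →* Abelianization G)).toAddMonoidHom.comp
      (proj p G).toAddMonoidHom), AddMonoidHom.range_comp,
    range_proj,
    ← AddMonoidHom.range_eq_map, card_range_mapDomainRingHom]
  · congr 1
    refine Nat.card_congr (Equiv.subtypeEquivRight fun u => ?_)
    rw [mem_gam_two_iff hG]
    change MonoidAlgebra.mapDomainRingHom (ZMod p) (powMonoidHom p) (proj p G _) = 0 ↔ _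
    rw [hpow, map_sub, map_one, sub_pow_char, one_pow, sub_eq_zero, map_pow, map_pow]
  · intro x hx
    change MonoidAlgebra.mapDomainRingHom (ZMod p) (powMonoidHom p) (proj p G _) = 0 at hx
    rw [hpow] at hx
    have h := congrArg (aug p _) hx
    rw [map_pow, map_zero, aug_proj] at h
    exact (pow_eq_zero_iff (Fact.out : p.Prime).ne_zero).1 h

omit hG in
theorem finite_smallAlgebra : Finite (SmallAlgebra p G) :=
  have := finite_monoidAlgebra (p := p) G
  Finite.of_surjective _ (Ideal.Quotient.mk_surjective (I := smallIdeal p G))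

variable {H : Type v} [Group H] [Finite H] (hH : IsPGroup p H)
include hH

/-- The order of A is p|S|. It also factors, in two ways, as a cardinal read off from S times p to
the wanted order, which is thereby determined. -/
theorem card_eq_of_smallUnits_equiv (f : SmallUnits p G ≃* SmallUnits p H) :
    Nat.card (gam (SmallUnits p G) 2) = Nat.card (gam (SmallUnits p H) 2) ∧
    Nat.card (Abelianization G) = Nat.card (Abelianization H) ∧
    Nat.card (powMonoidHom p : Abelianization G →* Abelianization G).range =
      Nat.card (powMonoidHom p : Abelianization H →* Abelianization H).range := by
  have := finite_smallAlgebra (p := p) (G := G)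
  have hp := (Fact.out : p.Prime).one_lt
  have h0 : Nat.card (SmallAlgebra p G) = Nat.card (SmallAlgebra p H) := by
    rw [card_smallAlgebra hG, card_smallAlgebra hH, Nat.card_congr f.toEquiv]
  have hpos : 0 < Nat.card (SmallAlgebra p G) := Nat.card_pos
  have h1 : Nat.card (gam (SmallUnits p G) 2) = Nat.card (gam (SmallUnits p H) 2) :=
    Nat.card_congr (f.toEquiv.subtypeEquiv fun u => (mulEquiv_mem_gam_iff f 2 u).symm)
  have h2 : Nat.card {u : SmallUnits p G // u ^ p ∈ gam (SmallUnits p G) 2} =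
      Nat.card {u : SmallUnits p H // u ^ p ∈ gam (SmallUnits p H) 2} := by
    refine Nat.card_congr (f.toEquiv.subtypeEquiv fun u => ?_)
    rw [← mulEquiv_mem_gam_iff f 2, map_pow]
    rfl
  refine ⟨h1, ?_, ?_⟩
  · have h3 := card_smallAlgebra_eq_gam_two hG
    have h4 := card_smallAlgebra_eq_gam_two hH
    rw [h3] at hpos
    rw [h3, h4, h1] at h0
    exact Nat.pow_right_injective hp
      (Nat.eq_of_mul_eq_mul_left (h1 ▸ Nat.pos_of_mul_pos_right hpos) h0)
  · have h3 := card_smallAlgebra_eq_pow hG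
    have h4 := card_smallAlgebra_eq_pow hH
    rw [h3] at hpos
    rw [h3, h4, h2] at h0
    exact Nat.pow_right_injective hp
      (Nat.eq_of_mul_eq_mul_left (h2 ▸ Nat.pos_of_mul_pos_right hpos) h0)

end Counting

/-! ### Linear algebra behind the correction -/

section LinearAlgebra

variable {k : Type*} [Field k]

theorem exists_linearMap_of_relations {V T ι : Type*} [AddCommGroup V] [Module k V]
    [AddCommGroup T] [Module k T] [Fintype ι] (c : ι → V) (t : ι → T)
    (h : ∀ a : ι → k, ∑ i, a i • c i = 0 → ∑ i, a i • t i = 0) :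
    ∃ δ : V →ₗ[k] T, ∀ i, δ (c i) = t i := by
  classical
  let L := Fintype.linearCombination k c
  let M := Fintype.linearCombination k t
  have hle : LinearMap.ker L ≤ LinearMap.ker M := fun a ha => h a ha
  obtain ⟨δ, hδ⟩ := LinearMap.exists_extend
    (((LinearMap.ker L).liftQ M hle).comp L.quotKerEquivRange.symm.toLinearMap)
  refine ⟨δ, fun i => ?_⟩
  have h1 : L (Pi.single i 1) = c i := by simp [L, Fintype.linearCombination_apply_single]
  have h2 : M (Pi.single i 1) = t i := by simp [M, Fintype.linearCombination_apply_single]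
  have h3 := LinearMap.congr_fun hδ ⟨L (Pi.single i 1), LinearMap.mem_range_self _ _⟩
  have h4 : L.quotKerEquivRange.symm ⟨L (Pi.single i 1), LinearMap.mem_range_self _ _⟩ =
      Submodule.Quotient.mk (Pi.single i 1) := by
    rw [LinearEquiv.symm_apply_eq]
    exact Subtype.ext (LinearMap.quotKerEquivRange_apply_mk L _).symm
  rw [← h1, ← h2]
  refine h3.trans ?_
  rw [LinearMap.comp_apply, LinearEquiv.coe_coe, h4]
  rfl

variable {V T : Type*} [AddCommGroup V] [Module k V] [AddCommGroup T] [Module k T]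

/-- The cross product of two relations satisfies the premise of `hc`, so it is 0: relations between
the c_i are at most a line. -/
theorem cross_eq_zero_of_relations (c : Fin 3 → V)
    (hc : ∀ a : Fin 3 → k, (∀ i j, a i • c j = a j • c i) → a = 0) {u v : Fin 3 → k}
    (hu : ∑ i, u i • c i = 0) (hv : ∑ i, v i • c i = 0) (i j : Fin 3) :
    u i * v j = u j * v i := by
  rw [Fin.sum_univ_three] at hu hv
  have h := hc ![u 1 * v 2 - u 2 * v 1, u 2 * v 0 - u 0 * v 2, u 0 * v 1 - u 1 * v 0] (by
    have e01 : (u 1 * v 2 - u 2 * v 1) • c 1 - (u 2 * v 0 - u 0 * v 2) • c 0 =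
        v 2 • (u 0 • c 0 + u 1 • c 1 + u 2 • c 2) -
          u 2 • (v 0 • c 0 + v 1 • c 1 + v 2 • c 2) := by module
    have e02 : (u 1 * v 2 - u 2 * v 1) • c 2 - (u 0 * v 1 - u 1 * v 0) • c 0 =
        u 1 • (v 0 • c 0 + v 1 • c 1 + v 2 • c 2) -
          v 1 • (u 0 • c 0 + u 1 • c 1 + u 2 • c 2) := by module
    have e12 : (u 2 * v 0 - u 0 * v 2) • c 2 - (u 0 * v 1 - u 1 * v 0) • c 1 =
        v 0 • (u 0 • c 0 + u 1 • c 1 + u 2 • c 2) -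
          u 0 • (v 0 • c 0 + v 1 • c 1 + v 2 • c 2) := by module
    rw [hu, hv, smul_zero, smul_zero, sub_zero, sub_eq_zero] at e01 e02 e12
    intro i j
    fin_cases i <;> fin_cases j <;> simp [e01, e02, e12])
  have h0 := congrFun h 0
  have h1 := congrFun h 1
  have h2 := congrFun h 2
  simp only [Matrix.cons_val, Pi.zero_apply, sub_eq_zero] at h0 h1 h2
  fin_cases i <;> fin_cases j <;> simp [h0, h1, h2]

/-- The added term is the change of [y_(i+1), y_(i+2)] when each y_i is multiplied by the s_i-th
power of the l-th commutator. If the c_i are dependent, one relation u spans all of them, and one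
scalar suffices to make the right-hand sides satisfy it. -/
theorem exists_linearMap_cross (c : Fin 3 → Fin 3 → T) (t : Fin 3 → T)
    (h : LinearIndependent k c ∨ ((∃ τ : T, ∀ t, ∃ a : k, t = a • τ) ∧
      ∀ a : Fin 3 → k, (∀ i j, a i • c j = a j • c i) → a = 0)) :
    ∃ (δ : (Fin 3 → T) →ₗ[k] T) (l : Fin 3) (s : Fin 3 → k),
      ∀ i, δ (c i) = t i + (s (i + 1) • c l (i + 2) - s (i + 2) • c l (i + 1)) := by
  by_cases hli : LinearIndependent k c
  · obtain ⟨δ, hδ⟩ := exists_linearMap_of_relations c t fun a ha =>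
      Finset.sum_eq_zero fun i _ => by
        rw [Fintype.linearIndependent_iff.1 hli a ha i, zero_smul]
    exact ⟨δ, 0, 0, fun i => by simp [hδ]⟩
  obtain ⟨⟨τ, hτ⟩, hc⟩ := h.resolve_left hli
  obtain ⟨u, hu, m, hm⟩ := Fintype.not_linearIndependent_iff.1 hli
  -- Otherwise each c_l is a multiple a_l of one fixed vector parallel to u. Then a satisfies the
  -- premise of `hc`, so a = 0 and all c_l vanish, which contradicts `hc` for (1, 1, 1).
  obtain ⟨l, j, hlj⟩ : ∃ l j, u (j + 2) • c l (j + 1) - u (j + 1) • c l (j + 2) ≠ 0 := by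
    by_contra! hall
    have hpar : ∀ l i j, u i • c l j = u j • c l i := by
      intro l i j
      have h0 := hall l 0
      have h1 := hall l 1
      have h2 := hall l 2
      simp only [sub_eq_zero] at h0 h1 h2
      fin_cases i <;> fin_cases j <;>
        first
        | rfl | exact h0 | exact h1 | exact h2 | exact h0.symm | exact h1.symm | exact h2.symm
    choose a ha using fun l => hτ (c l m)
    have hcl : ∀ l, c l = fun j => ((u m)⁻¹ * u j * a l) • τ := by
      intro l
      funext j
      rw [mul_smul, mul_smul, ← ha, ← hpar, smul_smul, inv_mul_cancel₀ hm, one_smul]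
    have ha0 : a = 0 := hc a fun i j => by
      rw [hcl i, hcl j]
      funext n
      simp only [Pi.smul_apply, smul_smul]
      congr 1; ring
    have hc0 : ∀ l, c l = 0 := by
      intro l
      rw [hcl l]; funext j; simp [ha0]
    have h1 := congrFun (hc (fun _ => 1) fun i j => by rw [hc0, hc0]) 0
    exact one_ne_zero h1
  set w := u (j + 2) • c l (j + 1) - u (j + 1) • c l (j + 2) with hw
  -- `T` is spanned by τ and w ≠ 0, so a multiple of w cancels ∑ u_i t_i. Taking s supported at j
  -- with value s0 produces exactly this multiple.
  obtain ⟨s0, hs0⟩ : ∃ s0 : k, ∑ i, u i • t i + s0 • w = 0 := by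
    obtain ⟨a, ha⟩ := hτ (∑ i, u i • t i)
    obtain ⟨b, hb⟩ := hτ w
    have hb0 : b ≠ 0 := by rintro rfl; exact hlj (by rw [hb, zero_smul])
    refine ⟨-a / b, ?_⟩
    rw [ha, hb, smul_smul, div_mul_cancel₀ _ hb0, neg_smul, add_neg_cancel]
  let s : Fin 3 → k := Pi.single j s0
  have hsum : ∑ i, u i • (t i + (s (i + 1) • c l (i + 2) - s (i + 2) • c l (i + 1))) = 0 := by
    rw [← hs0, hw]
    simp only [Fin.sum_univ_three, s]
    fin_cases j <;> simp <;> module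
  obtain ⟨δ, hδ⟩ := exists_linearMap_of_relations c
    (fun i => t i + (s (i + 1) • c l (i + 2) - s (i + 2) • c l (i + 1))) fun v hv => by
      have hv' : ∀ i, v i = v m * (u m)⁻¹ * u i := by
        intro i
        have := cross_eq_zero_of_relations c hc hu hv m i
        field_simp
        linear_combination this
      have : ∀ i, v i • (t i + (s (i + 1) • c l (i + 2) - s (i + 2) • c l (i + 1))) =
          (v m * (u m)⁻¹) •
            (u i • (t i + (s (i + 1) • c l (i + 2) - s (i + 2) • c l (i + 1)))) := by
        intro i
        rw [smul_smul, ← hv']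
      rw [Finset.sum_congr rfl fun i _ => this i, ← Finset.smul_sum, hsum, smul_zero]
  exact ⟨δ, l, s, hδ⟩

end LinearAlgebra

/-! ### Extending a homomorphism from a normal subgroup -/

section Graph

variable {X Y : Type*} [Group X] [Group Y]

/-- The subgroup generated by three commuting elements. -/
def zpowProducts {c : Fin 3 → X} (hc : ∀ i j, Commute (c i) (c j)) : Subgroup X where
  carrier := {g | ∃ a : Fin 3 → ℤ, g = c 0 ^ a 0 * c 1 ^ a 1 * c 2 ^ a 2}
  one_mem' := ⟨0, by simp⟩
  mul_mem' := by
    rintro _ _ ⟨a, rfl⟩ ⟨b, rfl⟩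
    refine ⟨a + b, ?_⟩
    have h10 := ((hc 1 0).zpow_zpow (a 1) (b 0)).eq
    have h20 := ((hc 2 0).zpow_zpow (a 2) (b 0)).eq
    have h21 := ((hc 2 1).zpow_zpow (a 2) (b 1)).eq
    simp only [Pi.add_apply, zpow_add]
    calc _ = c 0 ^ a 0 * c 1 ^ a 1 * (c 2 ^ a 2 * c 0 ^ b 0) * c 1 ^ b 1 * c 2 ^ b 2 := by
          simp only [mul_assoc]
      _ = c 0 ^ a 0 * (c 1 ^ a 1 * c 0 ^ b 0) * (c 2 ^ a 2 * c 1 ^ b 1) * c 2 ^ b 2 := by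
          rw [h20]; simp only [mul_assoc]
      _ = _ := by rw [h10, h21]; simp only [mul_assoc]
  inv_mem' := by
    rintro _ ⟨a, rfl⟩
    refine ⟨-a, ?_⟩
    have h10 := ((hc 1 0).zpow_zpow (-a 1) (-a 0)).eq
    have h20 := ((hc 2 0).zpow_zpow (-a 2) (-a 0)).eq
    have h21 := ((hc 2 1).zpow_zpow (-a 2) (-a 1)).eq
    simp only [mul_inv_rev, Pi.neg_apply, ← zpow_neg]
    calc _ = c 2 ^ (-a 2) * c 1 ^ (-a 1) * c 0 ^ (-a 0) := by simp only [mul_assoc]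
      _ = _ := by rw [h21, mul_assoc, h20, ← mul_assoc, h10]

/-- The z_i commute in the quotient of the normalizer of R by R. -/
theorem exists_zpow_products_mul (R : Subgroup X) (z : Fin 3 → X)
    (hz : ∀ i, z i ∈ Subgroup.normalizer (R : Set X)) (hc : ∀ i j, ⁅z i, z j⁆ ∈ R) {q : X}
    (hq : q ∈ Subgroup.closure (Set.range z)) :
    ∃ a : Fin 3 → ℤ, (z 0 ^ a 0 * z 1 ^ a 1 * z 2 ^ a 2)⁻¹ * q ∈ R := by
  let K := Subgroup.normalizer (R : Set X)
  let zK : Fin 3 → K := fun i => ⟨z i, hz i⟩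
  let π := QuotientGroup.mk' (R.subgroupOf K)
  have hcomm : ∀ i j, Commute (π (zK i)) (π (zK j)) := by
    intro i j
    rw [← commutatorElement_eq_one_iff_commute, ← map_commutatorElement]
    exact (QuotientGroup.eq_one_iff _).2 (hc i j)
  have hle : Subgroup.closure (Set.range z) ≤ ((zpowProducts hcomm).comap π).map K.subtype := by
    rw [Subgroup.closure_le]
    rintro _ ⟨i, rfl⟩
    refine ⟨zK i, ⟨Pi.single i 1, ?_⟩, rfl⟩
    fin_cases i <;> simp
  obtain ⟨q, ⟨a, ha⟩, rfl⟩ := hle hq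
  refine ⟨a, ?_⟩
  rw [← map_zpow, ← map_zpow, ← map_zpow, ← map_mul, ← map_mul] at ha
  have h : (zK 0 ^ a 0 * zK 1 ^ a 1 * zK 2 ^ a 2)⁻¹ * q ∈ R.subgroupOf K :=
    QuotientGroup.eq.1 ha.symm
  exact h

/-- A map on a normal subgroup extends to the whole group if it is compatible with the values of
generators. -/
theorem exists_monoidHom_of_compatible (N : Subgroup X) [N.Normal] (σ : N →* Y) (x : Fin 3 → X)
    (y : Fin 3 → Y) (q : Fin 3 → ℕ) (hx : Subgroup.closure (Set.range x) = ⊤)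
    (hind : ∀ a : Fin 3 → ℤ, x 0 ^ a 0 * x 1 ^ a 1 * x 2 ^ a 2 ∈ N → ∀ i, (q i : ℤ) ∣ a i)
    (hq : ∀ i, ∃ h : x i ^ q i ∈ N, σ ⟨_, h⟩ = y i ^ q i)
    (hcomm : ∀ i j, ∃ h : ⁅x i, x j⁆ ∈ N, σ ⟨_, h⟩ = ⁅y i, y j⁆)
    (hconj : ∀ i (n : N), ∃ h : ⁅(n : X), x i⁆ ∈ N, σ ⟨_, h⟩ = ⁅σ n, y i⁆) :
    ∃ φ : X →* Y, ∀ i, φ (x i) = y i := by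
  -- `R` is the graph of σ. The subgroup `Q` generated by the pairs (x_i, y_i) is the graph of the
  -- desired homomorphism as soon as it contains no (1, y) with y ≠ 1.
  let R : Subgroup (X × Y) := (N.subtype.prod σ).range
  let z : Fin 3 → X × Y := fun i => (x i, y i)
  have hR : ∀ n : N, ((n : X), σ n) ∈ R := fun n => ⟨n, rfl⟩
  have hR' : ∀ {r : X × Y}, (∃ h : r.1 ∈ N, σ ⟨_, h⟩ = r.2) → r ∈ R := by
    rintro ⟨r1, r2⟩ ⟨h, h'⟩
    exact ⟨⟨r1, h⟩, Prod.ext rfl h'⟩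
  have hconj' : ∀ i (n : N), z i * ((n : X), σ n) * (z i)⁻¹ ∈ R := by
    intro i n
    obtain ⟨h, hh⟩ := hconj i n
    have h1 : z i * ((n : X), σ n) * (z i)⁻¹ = (⁅(n : X), x i⁆, ⁅σ n, y i⁆)⁻¹ * ((n : X), σ n) := by
      ext <;> simp [z, commutatorElement_def, mul_assoc]
    rw [h1, ← hh]
    exact mul_mem (inv_mem (hR ⟨_, h⟩)) (hR n)
  have hz : ∀ i, z i ∈ Subgroup.normalizer (R : Set (X × Y)) := by
    intro i
    rw [Subgroup.mem_normalizer_iff]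
    intro r
    constructor
    · rintro ⟨n, rfl⟩
      exact hconj' i n
    · rintro ⟨n, hn⟩
      have hm : (x i)⁻¹ * n * x i ∈ N := by
        simpa using (inferInstance : N.Normal).conj_mem n n.2 (x i)⁻¹
      obtain ⟨m, hm'⟩ := hconj' i ⟨_, hm⟩
      have h1 : m = n := by
        have := congrArg Prod.fst hm'
        refine Subtype.ext (this.trans ?_)
        simp [z, mul_assoc]
      have h2 : r = ((x i)⁻¹ * n * x i, σ ⟨_, hm⟩) := by
        have := hn.symm.trans (h1 ▸ hm')
        exact mul_left_cancel (mul_right_cancel this)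
      rw [h2]
      exact hR ⟨_, hm⟩
  have hc : ∀ i j, ⁅z i, z j⁆ ∈ R := fun i j => hR' (hcomm i j)
  have hzq : ∀ i, z i ^ q i ∈ R := fun i => hR' (hq i)
  let Q := Subgroup.closure (Set.range z)
  -- Modulo `R`, r is a product of powers z_i^(a_i). If its first component is 1, `hind` gives q_i ∣
  -- a_i, so these powers lie in `R` and so does r; but `R` is a graph.
  have hQR : ∀ r ∈ Q, r.1 = 1 → r = 1 := by
    intro r hr hr1
    obtain ⟨a, ha⟩ := exists_zpow_products_mul R z hz hc hr
    have h1 : x 0 ^ a 0 * x 1 ^ a 1 * x 2 ^ a 2 ∈ N := by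
      obtain ⟨n, hn⟩ := ha
      have h2 : (n : X) = (x 0 ^ a 0 * x 1 ^ a 1 * x 2 ^ a 2)⁻¹ := by
        have h3 := congrArg Prod.fst hn
        refine h3.trans ?_
        simp [z, hr1]
      rw [← inv_mem_iff, ← h2]
      exact n.2
    have h2 : ∀ i, z i ^ a i ∈ R := by
      intro i
      obtain ⟨b, hb⟩ := hind a h1 i
      rw [hb, zpow_mul, zpow_natCast]
      exact zpow_mem (hzq i) b
    have h3 : r ∈ R := by
      have := mul_mem (mul_mem (mul_mem (h2 0) (h2 1)) (h2 2)) ha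
      rwa [mul_inv_cancel_left] at this
    obtain ⟨n, rfl⟩ := h3
    have h4 : n = 1 := Subtype.ext hr1
    rw [h4, map_one]
  have hinj : Function.Injective ((MonoidHom.fst X Y).comp Q.subtype) :=
    (injective_iff_map_eq_one _).2 fun r hr => Subtype.ext (hQR r r.2 hr)
  have hsurj : Function.Surjective ((MonoidHom.fst X Y).comp Q.subtype) := by
    rw [← MonoidHom.range_eq_top, eq_top_iff, ← hx, Subgroup.closure_le]
    rintro _ ⟨i, rfl⟩
    exact ⟨⟨z i, Subgroup.subset_closure ⟨i, rfl⟩⟩, rfl⟩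
  let E := MulEquiv.ofBijective _ ⟨hinj, hsurj⟩
  refine ⟨((MonoidHom.snd X Y).comp Q.subtype).comp E.symm.toMonoidHom, fun i => ?_⟩
  have : E.symm (x i) = ⟨z i, Subgroup.subset_closure ⟨i, rfl⟩⟩ := by
    rw [MulEquiv.symm_apply_eq]; rfl
  change (E.symm (x i)).1.2 = y i
  rw [this]

theorem commutator_mem_of_closure_eq_top (P : Subgroup X) [P.Normal] {s : Set X}
    (hs : Subgroup.closure s = ⊤) {g : X} (hg : ∀ h ∈ s, ⁅g, h⁆ ∈ P) (h : X) : ⁅g, h⁆ ∈ P := by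
  let π := QuotientGroup.mk' P
  have key : ∀ h, ⁅g, h⁆ ∈ P ↔ h ∈ (Subgroup.centralizer {π g}).comap π := by
    intro h
    rw [Subgroup.mem_comap, Subgroup.mem_centralizer_singleton_iff, ← QuotientGroup.eq_one_iff]
    change π ⁅g, h⁆ = 1 ↔ _
    rw [map_commutatorElement, commutatorElement_eq_one_iff_mul_comm]
    exact eq_comm
  have hle : Subgroup.closure s ≤ (Subgroup.centralizer {π g}).comap π :=
    (Subgroup.closure_le _).2 fun h hh => (key h).1 (hg h hh)
  exact (key h).2 (hle (hs ▸ Subgroup.mem_top h))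

theorem commutator_le_of_closure_eq_top (P : Subgroup X) [P.Normal] {s : Set X}
    (hs : Subgroup.closure s = ⊤) (hc : ∀ g ∈ s, ∀ h ∈ s, ⁅g, h⁆ ∈ P) : gam X 2 ≤ P := by
  change ⁅(⊤ : Subgroup X), ⊤⁆ ≤ P
  rw [Subgroup.commutator_le]
  intro g _ h _
  refine commutator_mem_of_closure_eq_top P hs (fun k hk => ?_) h
  rw [← commutatorElement_inv]
  exact inv_mem (commutator_mem_of_closure_eq_top P hs (hc k hk) g)

end Graph

/-! ### Commutator calculus when γ_4 = 1 -/

section ClassThree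

variable {X : Type*} [Group X]

theorem commutator_mem_gam_two (a b : X) : ⁅a, b⁆ ∈ gam X 2 :=
  Subgroup.commutator_mem_commutator (Subgroup.mem_top a) (Subgroup.mem_top b)

theorem commutator_mem_gam_three' {n : X} (hn : n ∈ gam X 2) (b : X) : ⁅n, b⁆ ∈ gam X 3 :=
  commutator_mem_gam_succ (by lia) hn b

theorem gam_three_le_gam_two : gam X 3 ≤ gam X 2 := gam_antitone (by lia)

/-- The commutator of two elements, as an element of `γ_2`. -/
def comm₂ (a b : X) : gam X 2 := ⟨⁅a, b⁆, commutator_mem_gam_two a b⟩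

/-- The commutator of an element of `γ_2` with an element, as an element of `γ_3`. -/
def comm₃ (n : gam X 2) (b : X) : gam X 3 := ⟨⁅(n : X), b⁆, commutator_mem_gam_three' n.2 b⟩

theorem gam_three_central (h4 : gam X 4 = ⊥) {m : X} (hm : m ∈ gam X 3) (s : X) :
    m * s = s * m := by
  have h := commutator_mem_gam_succ (by lia) hm s
  rw [h4, Subgroup.mem_bot] at h
  exact commutatorElement_eq_one_iff_mul_comm.1 h

theorem gam_two_comm (h4 : gam X 4 = ⊥) {a b : X} (ha : a ∈ gam X 2) (hb : b ∈ gam X 2) :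
    a * b = b * a := by
  have h : ⁅⁅(⊤ : Subgroup X), (⊤ : Subgroup X)⁆, gam X 2⁆ = ⊥ := by
    refine Subgroup.commutator_commutator_eq_bot_of_rotate ?_ h4
    rw [Subgroup.commutator_comm (⊤ : Subgroup X) (gam X 2)]
    exact h4
  have h1 : ⁅a, b⁆ ∈ (⊥ : Subgroup X) := h ▸ Subgroup.commutator_mem_commutator ha hb
  exact commutatorElement_eq_one_iff_mul_comm.1 (Subgroup.mem_bot.1 h1)

theorem commutator_mul_left (h4 : gam X 4 = ⊥) (a : X) {n : X} (hn : n ∈ gam X 2) (s : X) :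
    ⁅a * n, s⁆ = ⁅a, s⁆ * ⁅n, s⁆ := by
  have h1 := gam_three_central h4 (commutator_mem_gam_three' hn s)
  calc ⁅a * n, s⁆ = a * (⁅n, s⁆ * (s * a⁻¹ * s⁻¹)) := by
        simp [commutatorElement_def, mul_assoc]
    _ = ⁅a, s⁆ * ⁅n, s⁆ := by rw [h1]; simp [commutatorElement_def, mul_assoc]

theorem commutator_mul_mul (h4 : gam X 4 = ⊥) (a b : X) {m n : X} (hm : m ∈ gam X 2)
    (hn : n ∈ gam X 2) : ⁅a * m, b * n⁆ = ⁅a, b⁆ * ⁅m, b⁆ * ⁅n, a⁆⁻¹ := by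
  have h1 : ∀ s, ⁅s, b * n⁆ = ⁅s, b⁆ * ⁅n, s⁆⁻¹ := by
    intro s
    have hc := gam_three_central h4 (inv_mem (commutator_mem_gam_three' hn s))
    rw [← commutatorElement_inv (b * n), commutator_mul_left h4 b hn, mul_inv_rev, hc,
      commutatorElement_inv b]
  have h2 : ⁅n, m⁆ = 1 := commutatorElement_eq_one_iff_mul_comm.2 (gam_two_comm h4 hn hm)
  rw [commutator_mul_left h4 a hm, h1, h1, h2, inv_one, mul_one, mul_assoc, mul_assoc]
  congr 1
  exact gam_three_central h4 (inv_mem (commutator_mem_gam_three' hn a)) _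

theorem mul_gam_two_pow {p e : ℕ} (hp : p.Prime) (hp2 : p ≠ 2) (he : 1 ≤ e) (h4 : gam X 4 = ⊥)
    (hexp : ∀ n ∈ gam X 2, n ^ p = 1) (a : X) {n : X} (hn : n ∈ gam X 2) :
    (a * n) ^ p ^ e = a ^ p ^ e := by
  have hc : ⁅n⁻¹, a⁻¹⁆ ∈ gam X 3 := commutator_mem_gam_three' (inv_mem hn) _
  rw [mul_pow_prime_pow hp hp2 he (gam_three_central h4 hc _) (gam_three_central h4 hc _)
    (hexp _ (gam_three_le_gam_two hc))]
  obtain ⟨d, rfl⟩ := Nat.exists_eq_add_of_le' he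
  rw [pow_succ' p, pow_mul n, hexp n hn, one_pow, mul_one]

/-- A conjugate of a is a times an element of γ_2, which does not affect the p^e-th power. -/
theorem pow_mem_center {p e : ℕ} (hp : p.Prime) (hp2 : p ≠ 2) (he : 1 ≤ e) (h4 : gam X 4 = ⊥)
    (hexp : ∀ n ∈ gam X 2, n ^ p = 1) (a : X) : a ^ p ^ e ∈ Subgroup.center X := by
  rw [Subgroup.mem_center_iff]
  intro g
  have h := mul_gam_two_pow hp hp2 he h4 hexp a (commutator_mem_gam_two a⁻¹ g)
  have h1 : a * ⁅a⁻¹, g⁆ = g * a * g⁻¹ := by simp [commutatorElement_def, mul_assoc]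
  rw [h1, conj_pow] at h
  exact mul_inv_eq_iff_eq_mul.1 h

variable (h4 : gam X 4 = ⊥) (x : Fin 3 → X) {T : Type*} [AddCommGroup T]
  (τ : gam X 3 ≃* Multiplicative T)

/-- The commutators with three given elements, as a map on `γ_2`. -/
def brk : gam X 2 →* Multiplicative (Fin 3 → T) where
  toFun n := Multiplicative.ofAdd fun j => (τ (comm₃ n (x j))).toAdd
  map_one' := by
    have h : ∀ j, comm₃ (1 : gam X 2) (x j) = 1 := fun j =>
      Subtype.ext (commutatorElement_one_left _)
    simp only [h, map_one]
    rfl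
  map_mul' m n := by
    have h : ∀ j, comm₃ (m * n) (x j) = comm₃ m (x j) * comm₃ n (x j) := fun j =>
      Subtype.ext (commutator_mul_left h4 m n.2 (x j))
    simp only [h, map_mul]
    rfl

theorem brk_apply (n : gam X 2) (j : Fin 3) :
    (brk h4 x τ n).toAdd j = (τ (comm₃ n (x j))).toAdd := rfl

theorem brk_eq_one_of_mem_center {n : gam X 2} (hn : (n : X) ∈ Subgroup.center X) :
    brk h4 x τ n = 1 := by
  refine Multiplicative.toAdd.injective (funext fun j => ?_)
  rw [brk_apply]
  have : comm₃ n (x j) = 1 :=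
    Subtype.ext (commutatorElement_eq_one_iff_mul_comm.2 (Subgroup.mem_center_iff.1 hn _).symm)
  rw [this, map_one]
  rfl

theorem brk_eq_one_of_mem_gam_three {n : gam X 2} (hn : (n : X) ∈ gam X 3) :
    brk h4 x τ n = 1 :=
  brk_eq_one_of_mem_center h4 x τ
    (Subgroup.mem_center_iff.2 fun g => (gam_three_central h4 hn g).symm)

theorem mem_center_of_brk_eq_one (hx : Subgroup.closure (Set.range x) = ⊤) {n : gam X 2}
    (hn : brk h4 x τ n = 1) : (n : X) ∈ Subgroup.center X := by
  rw [Subgroup.mem_center_iff]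
  intro g
  have h : ⁅(n : X), g⁆ ∈ (⊥ : Subgroup X) := by
    refine commutator_mem_of_closure_eq_top ⊥ hx ?_ g
    rintro _ ⟨j, rfl⟩
    have h1 : (τ (comm₃ n (x j))).toAdd = 0 := by
      rw [← brk_apply h4, hn]; rfl
    have h2 : comm₃ n (x j) = 1 := τ.injective (by rw [map_one]; exact h1)
    exact congrArg Subtype.val h2
  exact (commutatorElement_eq_one_iff_mul_comm.1 (Subgroup.mem_bot.1 h)).symm

/-- Commutators are bilinear modulo γ_3, and `brk` kills γ_3. -/
theorem brk_comm₂_mul (a b s : X) :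
    brk h4 x τ (comm₂ (a * b) s) = brk h4 x τ (comm₂ a s) * brk h4 x τ (comm₂ b s) := by
  have h : comm₂ (a * b) s = ⟨⁅a, (comm₂ b s : X)⁆, commutator_mem_gam_two _ _⟩ *
      comm₂ b s * comm₂ a s :=
    Subtype.ext (by simp [comm₂, commutatorElement_def, mul_assoc])
  have h1 : ⁅a, (comm₂ b s : X)⁆ ∈ gam X 3 := by
    rw [← commutatorElement_inv]
    exact inv_mem (commutator_mem_gam_three' (comm₂ b s).2 a)
  rw [h, map_mul, map_mul, brk_eq_one_of_mem_gam_three h4 x τ h1, one_mul, mul_comm]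

theorem brk_comm₂_pow (a s : X) (m : ℕ) :
    brk h4 x τ (comm₂ (a ^ m) s) = brk h4 x τ (comm₂ a s) ^ m := by
  induction m with
  | zero =>
    have : comm₂ (a ^ 0) s = 1 := Subtype.ext (by simp [comm₂])
    rw [this, map_one, pow_zero]
  | succ m ih => rw [pow_succ, brk_comm₂_mul, ih, pow_succ]

theorem brk_comm₂_swap (a b : X) : brk h4 x τ (comm₂ a b) = (brk h4 x τ (comm₂ b a))⁻¹ := by
  rw [← map_inv]
  congr 1
  exact Subtype.ext (commutatorElement_inv b a).symm

/-- The values of `brk` at the commutators of the three elements. -/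
def brkComm (i : Fin 3) : Fin 3 → T := (brk h4 x τ (comm₂ (x (i + 1)) (x (i + 2)))).toAdd

variable {p : ℕ} [Fact p.Prime] [Module (ZMod p) T]

/-- The elements of γ_2 with this property form a normal subgroup, since it contains γ_3; it
contains the commutators of the generators, hence all of γ_2. -/
theorem brk_mem_span (hx : Subgroup.closure (Set.range x) = ⊤) (n : gam X 2) :
    (brk h4 x τ n).toAdd ∈ Submodule.span (ZMod p) (Set.range (brkComm h4 x τ)) := by
  let L := Submodule.span (ZMod p) (Set.range (brkComm h4 x τ))
  let P : Subgroup X :=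
    ((AddSubgroup.toSubgroup L.toAddSubgroup).comap (brk h4 x τ)).map (gam X 2).subtype
  have hP : ∀ {n : X}, n ∈ P ↔ ∃ h : n ∈ gam X 2, (brk h4 x τ ⟨n, h⟩).toAdd ∈ L := by
    intro n
    constructor
    · rintro ⟨m, hm, rfl⟩
      exact ⟨m.2, hm⟩
    · rintro ⟨h, h'⟩
      exact ⟨⟨n, h⟩, h', rfl⟩
  have h3 : gam X 3 ≤ P := by
    intro m hm
    refine hP.2 ⟨gam_three_le_gam_two hm, ?_⟩
    rw [brk_eq_one_of_mem_gam_three h4 x τ hm]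
    exact zero_mem L
  have : P.Normal := ⟨fun n hn g => by
    have h1 : g * n * g⁻¹ = ⁅n, g⁆⁻¹ * n := by simp [commutatorElement_def, mul_assoc]
    rw [h1]
    exact mul_mem (inv_mem (h3 (commutator_mem_gam_three' (hP.1 hn).1 g))) hn⟩
  have hc : ∀ i, ⁅x (i + 1), x (i + 2)⁆ ∈ P := fun i =>
    hP.2 ⟨commutator_mem_gam_two _ _, Submodule.subset_span ⟨i, rfl⟩⟩
  have hc' : ∀ i, ⁅x (i + 2), x (i + 1)⁆ ∈ P := fun i => by
    rw [← commutatorElement_inv]; exact inv_mem (hc i)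
  have hle := commutator_le_of_closure_eq_top P hx (by
    rintro _ ⟨i, rfl⟩ _ ⟨j, rfl⟩
    fin_cases i <;> fin_cases j <;>
      first
      | exact hc 0 | exact hc 1 | exact hc 2 | exact hc' 0 | exact hc' 1 | exact hc' 2
      | (rw [commutatorElement_self]; exact one_mem P))
  exact (hP.1 (hle n.2)).2

/-- The kernel of `brk` is Γ, so its image has p^3 elements; it lies in the span of three vectors.
-/
theorem linearIndependent_brkComm (hx : Subgroup.closure (Set.range x) = ⊤)
    (hcard : (capGam X).relIndex (gam X 2) = p ^ 3) :
    LinearIndependent (ZMod p) (brkComm h4 x τ) := by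
  let L := Submodule.span (ZMod p) (Set.range (brkComm h4 x τ))
  have hker : (brk h4 x τ).ker = (capGam X).subgroupOf (gam X 2) := by
    ext n
    rw [MonoidHom.mem_ker, Subgroup.mem_subgroupOf]
    exact ⟨fun h => ⟨mem_center_of_brk_eq_one h4 x τ hx h, n.2⟩,
      fun h => brk_eq_one_of_mem_center h4 x τ h.1⟩
  have h1 : Nat.card (brk h4 x τ).range = p ^ 3 := by
    rw [← Subgroup.index_ker, hker]; exact hcard
  have hfin : Module.Finite (ZMod p) L := Module.Finite.span_of_finite _ (Set.finite_range _)
  have hfin' : Finite L := Module.finite_of_finite (ZMod p)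
  have h2 : p ^ 3 ≤ Nat.card L := by
    rw [← h1]
    refine Nat.card_le_card_of_injective
      (fun r : (brk h4 x τ).range => (⟨(r : Multiplicative (Fin 3 → T)).toAdd, ?_⟩ : L)) ?_
    · obtain ⟨_, n, rfl⟩ := r
      exact brk_mem_span h4 x τ hx n
    · intro r s h
      exact Subtype.ext (Multiplicative.toAdd.injective (congrArg (fun v : L => (v : Fin 3 → T)) h))
  rw [Module.natCard_eq_pow_finrank (K := ZMod p), Nat.card_zmod] at h2
  have h3 : 3 ≤ Module.finrank (ZMod p) L :=
    (Nat.pow_le_pow_iff_right (Fact.out : p.Prime).one_lt).1 h2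
  rw [linearIndependent_iff_card_le_finrank_span, Fintype.card_fin]
  exact h3

/-- For g = x_0^(a_0) x_1^(a_1) x_2^(a_2), the values of `brk` at [g, x_j] are, up to sign, the
differences a_i c_l - a_l c_i. If they vanish, every [g, x_j] is central, so g ∈ Z_2 and p divides
the exponents. -/
theorem eq_zero_of_brkComm (hx : Subgroup.closure (Set.range x) = ⊤)
    (hR : ∀ a : Fin 3 → ℕ, x 0 ^ a 0 * x 1 ^ a 1 * x 2 ^ a 2 ∈ Subgroup.upperCentralSeries X 2 →
      ∀ i, p ∣ a i)
    (a : Fin 3 → ZMod p)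
    (ha : ∀ i j, a i • brkComm h4 x τ j = a j • brkComm h4 x τ i) : a = 0 := by
  let g := x 0 ^ (a 0).val * x 1 ^ (a 1).val * x 2 ^ (a 2).val
  have hval : ∀ (i : Fin 3) (v : Fin 3 → T), (a i).val • v = a i • v := by
    intro i v
    rw [← Nat.cast_smul_eq_nsmul (ZMod p), ZMod.natCast_zmod_val]
  have hg : ∀ s, (brk h4 x τ (comm₂ g s)).toAdd =
      a 0 • (brk h4 x τ (comm₂ (x 0) s)).toAdd + a 1 • (brk h4 x τ (comm₂ (x 1) s)).toAdd +
        a 2 • (brk h4 x τ (comm₂ (x 2) s)).toAdd := by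
    intro s
    rw [brk_comm₂_mul, brk_comm₂_mul, brk_comm₂_pow, brk_comm₂_pow, brk_comm₂_pow, toAdd_mul,
      toAdd_mul, toAdd_pow, toAdd_pow, toAdd_pow, hval, hval, hval]
  have hself : ∀ i, (brk h4 x τ (comm₂ (x i) (x i))).toAdd = 0 := by
    intro i
    have : comm₂ (x i) (x i) = 1 := Subtype.ext (commutatorElement_self _)
    rw [this, map_one]; rfl
  have hpos : ∀ i, (brk h4 x τ (comm₂ (x (i + 1)) (x (i + 2)))).toAdd = brkComm h4 x τ i :=
    fun i => rfl
  have hneg : ∀ i, (brk h4 x τ (comm₂ (x (i + 2)) (x (i + 1)))).toAdd = -brkComm h4 x τ i := by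
    intro i
    rw [brk_comm₂_swap, toAdd_inv, hpos]
  have hgx : ∀ j, ⁅g, x j⁆ ∈ Subgroup.center X := by
    intro j
    refine mem_center_of_brk_eq_one h4 x τ hx (n := comm₂ g (x j)) ?_
    refine Multiplicative.toAdd.injective ?_
    rw [hg, toAdd_one]
    have p0 := hpos 0
    have p1 := hpos 1
    have p2 := hpos 2
    have n0 := hneg 0
    have n1 := hneg 1
    have n2 := hneg 2
    simp only [Fin.isValue, zero_add, Fin.reduceAdd] at p0 p1 p2 n0 n1 n2
    fin_cases j
    · simp only [Fin.zero_eta, hself, p1, n2, smul_neg, smul_zero, zero_add, ha 1 2,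
        neg_add_cancel]
    · simp only [Fin.mk_one, hself, p2, n0, smul_neg, smul_zero, add_zero, ha 0 2,
        add_neg_cancel]
    · simp only [Fin.reduceFinMk, hself, p0, n1, smul_neg, smul_zero, add_zero, ha 0 1,
        neg_add_cancel]
  have hZ : g ∈ Subgroup.upperCentralSeries X 2 := by
    rw [Subgroup.mem_upperCentralSeries_succ_iff]
    intro h
    rw [Subgroup.upperCentralSeries_one]
    refine commutator_mem_of_closure_eq_top _ hx ?_ h
    rintro _ ⟨j, rfl⟩
    exact hgx j
  funext i
  have := hR (fun i => (a i).val) hZ i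
  rw [Pi.zero_apply, ← ZMod.natCast_zmod_val (a i)]
  exact (ZMod.natCast_eq_zero_iff _ _).2 this

end ClassThree

theorem exists_smul_of_card_eq {p : ℕ} [Fact p.Prime] {T : Type*} [AddCommGroup T]
    [Module (ZMod p) T] (hT : Nat.card T = p) : ∃ τ : T, ∀ t, ∃ a : ZMod p, t = a • τ := by
  have hp := (Fact.out : p.Prime)
  have hfin : Finite T := Nat.finite_of_card_ne_zero (by rw [hT]; exact hp.ne_zero)
  have hnt : Nontrivial T := Finite.one_lt_card_iff_nontrivial.1 (by rw [hT]; exact hp.one_lt)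
  obtain ⟨τ, hτ⟩ := exists_ne (0 : T)
  have hinj : Function.Injective fun a : ZMod p => a • τ := smul_left_injective _ hτ
  have hbij := (Nat.bijective_iff_injective_and_card _).2 ⟨hinj, by rw [hT, Nat.card_zmod]⟩
  exact ⟨τ, fun t => (hbij.2 t).imp fun a ha => ha.symm⟩

/-! ### Correcting the map of derived subgroups -/

section Core

variable {p : ℕ} [Fact p.Prime] {X Y : Type*} [Group X] [Group Y]

theorem commutator_mul_central {a z b m : Y} (hz : ∀ s, z * s = s * z) (hm : m * a = a * m) :
    ⁅a * z, b * m⁆ = ⁅a, b⁆ := by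
  have h1 : m * a⁻¹ = a⁻¹ * m := (Commute.inv_right (show Commute m a from hm)).eq
  calc ⁅a * z, b * m⁆ = a * (z * (b * m)) * z⁻¹ * a⁻¹ * m⁻¹ * b⁻¹ := by
        simp [commutatorElement_def, mul_assoc]
    _ = a * b * (m * a⁻¹) * m⁻¹ * b⁻¹ := by rw [hz]; simp [mul_assoc]
    _ = ⁅a, b⁆ := by rw [h1]; simp [commutatorElement_def, mul_assoc]

/-- A map between the derived subgroups that is compatible with the commutators only modulo `γ_3`
can be corrected so that it extends to the whole group. -/
theorem exists_monoidHom_of_derived (hp2 : p ≠ 2) (h4X : gam X 4 = ⊥) (h4Y : gam Y 4 = ⊥)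
    (hexpX : ∀ n ∈ gam X 2, n ^ p = 1) (hexpY : ∀ n ∈ gam Y 2, n ^ p = 1)
    (x : Fin 3 → X) (hx : Subgroup.closure (Set.range x) = ⊤) (e : Fin 3 → ℕ) (he : ∀ i, 1 ≤ e i)
    (hxe : ∀ i, x i ^ p ^ e i ∈ gam X 2)
    (hind : ∀ a : Fin 3 → ℤ, x 0 ^ a 0 * x 1 ^ a 1 * x 2 ^ a 2 ∈ gam X 2 →
      ∀ i, ((p ^ e i : ℕ) : ℤ) ∣ a i)
    {T : Type*} [AddCommGroup T] [Module (ZMod p) T] (τ : gam X 3 ≃* Multiplicative T)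
    (hT : LinearIndependent (ZMod p) (brkComm h4X x τ) ∨
      ((∃ t₀ : T, ∀ t, ∃ a : ZMod p, t = a • t₀) ∧
      ∀ a : Fin 3 → ZMod p,
        (∀ i j, a i • brkComm h4X x τ j = a j • brkComm h4X x τ i) → a = 0))
    (y : Fin 3 → Y) (f : gam X 2 →* Y) (hf2 : ∀ n, f n ∈ gam Y 2)
    (hf3 : ∀ n : gam X 2, (n : X) ∈ gam X 3 → f n ∈ gam Y 3)
    (hfy : ∀ (n : gam X 2) i, f (comm₂ (n : X) (x i)) = ⁅f n, y i⁆)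
    (hfc : ∀ i j, ∃ m : gam X 3,
      f (comm₂ (x i) (x j) * ⟨m, gam_three_le_gam_two m.2⟩) = ⁅y i, y j⁆)
    (hfp : ∀ i, f ⟨_, hxe i⟩ = y i ^ p ^ e i) :
    ∃ (φ : X →* Y) (n : Fin 3 → gam Y 2), ∀ i, φ (x i) = y i * n i := by
  have hp := (Fact.out : p.Prime)
  let ι : gam X 3 →* gam X 2 := Subgroup.inclusion gam_three_le_gam_two
  choose t ht using hfc
  obtain ⟨δ, l, s, hδ⟩ := exists_linearMap_cross (brkComm h4X x τ)
    (fun i => (τ (t (i + 1) (i + 2))).toAdd) hT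
  -- `D₀` factors through `brk`, so twisting f by it changes nothing on central elements of γ_2.
  let D₀ : gam X 2 → gam X 3 := fun n => τ.symm (Multiplicative.ofAdd (δ (brk h4X x τ n).toAdd))
  have hD₀mul : ∀ m n, D₀ (m * n) = D₀ m * D₀ n := by
    intro m n
    simp only [D₀, map_mul, toAdd_mul, map_add, ofAdd_add]
  have hD₀one : D₀ 1 = 1 := by simp [D₀]
  have hcentX : ∀ (m : gam X 3) (n : gam X 2), ι m * n = n * ι m := fun m n =>
    Subtype.ext (gam_three_central h4X m.2 n)
  let σ : gam X 2 →* Y := f.comp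
    { toFun := fun n => n * ι (D₀ n)
      map_one' := by rw [hD₀one, map_one, one_mul]
      map_mul' := fun m n => by
        rw [hD₀mul, map_mul, mul_assoc m, ← mul_assoc n, ← hcentX (D₀ m) n]
        simp only [mul_assoc] }
  have hσ : ∀ n, σ n = f n * f (ι (D₀ n)) := fun n => map_mul f _ _
  have hσ1 : ∀ n, brk h4X x τ n = 1 → σ n = f n := by
    intro n hn
    have : D₀ n = 1 := by simp [D₀, hn]
    rw [hσ, this, map_one, map_one, mul_one]
  let k : gam X 2 := comm₂ (x (l + 1)) (x (l + 2))
  -- All corrections of the y_i are powers of one element, the image of the commutator selected by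
  -- `l`.
  let n : Fin 3 → gam Y 2 := fun i => ⟨f k ^ (s i).val, pow_mem (hf2 k) _⟩
  have hkc : ∀ i j, ⁅(n i : Y), y j⁆ = f (ι (comm₃ k (x j))) ^ (s i).val := by
    intro i j
    have h1 : ∀ m : ℕ, ⁅f k ^ m, y j⁆ = ⁅f k, y j⁆ ^ m := by
      intro m
      induction m with
      | zero => simp
      | succ m ih => rw [pow_succ, commutator_mul_left h4Y _ (hf2 k), ih, pow_succ]
    change ⁅f k ^ (s i).val, y j⁆ = _
    rw [h1, ← hfy]
    rfl
  have hval : ∀ (i : Fin 3) (v : T), (s i).val • v = s i • v := by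
    intro i v
    rw [← Nat.cast_smul_eq_nsmul (ZMod p), ZMod.natCast_zmod_val]
  have hσc : ∀ i, σ (comm₂ (x (i + 1)) (x (i + 2))) =
      ⁅y (i + 1) * n (i + 1), y (i + 2) * n (i + 2)⁆ := by
    intro i
    have hD : D₀ (comm₂ (x (i + 1)) (x (i + 2))) = t (i + 1) (i + 2) *
        comm₃ k (x (i + 2)) ^ (s (i + 1)).val * (comm₃ k (x (i + 1)) ^ (s (i + 2)).val)⁻¹ := by
      apply τ.injective
      rw [map_mul, map_mul, map_inv, map_pow, map_pow, MulEquiv.apply_symm_apply]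
      apply Multiplicative.toAdd.injective
      rw [toAdd_mul, toAdd_mul, toAdd_inv, toAdd_pow, toAdd_pow, hval, hval]
      refine (hδ i).trans ?_
      rw [add_sub_assoc', sub_eq_add_neg]
      rfl
    rw [hσ, hD, commutator_mul_mul h4Y _ _ (n (i + 1)).2 (n (i + 2)).2, hkc, hkc,
      ← ht (i + 1) (i + 2)]
    simp only [map_mul, map_inv, map_pow, mul_assoc]
    rfl
  have hσc' : ∀ i, σ (comm₂ (x (i + 2)) (x (i + 1))) =
      ⁅y (i + 2) * n (i + 2), y (i + 1) * n (i + 1)⁆ := by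
    intro i
    have h1 : comm₂ (x (i + 2)) (x (i + 1)) = (comm₂ (x (i + 1)) (x (i + 2)))⁻¹ :=
      Subtype.ext (commutatorElement_inv _ _).symm
    rw [h1, map_inv, hσc, commutatorElement_inv]
  -- The exact identities survive: x_i^(p^(e_i)) and [m, x_i] are central, so σ = f there; factors
  -- from γ_2 do not change p^(e_i)-th powers, and [f(m), y_i] ignores the central factor from γ_3
  -- and the factor n_i, which commutes with f(m).
  obtain ⟨φ, hφ⟩ := exists_monoidHom_of_compatible (gam X 2) σ x (fun i => y i * n i)
    (fun i => p ^ e i) hx hind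
    (fun i => ⟨hxe i, by
      rw [hσ1 _ (brk_eq_one_of_mem_center h4X x τ
        (pow_mem_center hp hp2 (he i) h4X hexpX (x i))), hfp,
        mul_gam_two_pow hp hp2 (he i) h4Y hexpY _ (n i).2]⟩)
    (fun i j => ⟨commutator_mem_gam_two _ _, by
      have hself : ∀ i, σ (comm₂ (x i) (x i)) = ⁅y i * n i, y i * n i⁆ := by
        intro i
        have h1 : comm₂ (x i) (x i) = 1 := Subtype.ext (commutatorElement_self _)
        rw [h1, map_one, commutatorElement_self]
      change σ (comm₂ (x i) (x j)) = _
      fin_cases i <;> fin_cases j <;>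
        first
        | exact hself _ | exact hσc 0 | exact hσc 1 | exact hσc 2
        | exact hσc' 0 | exact hσc' 1 | exact hσc' 2⟩)
    (fun i m => ⟨commutator_mem_gam_two _ _, by
      change σ (comm₂ (m : X) (x i)) = _
      rw [hσ1 _ (brk_eq_one_of_mem_gam_three h4X x τ (commutator_mem_gam_three' m.2 (x i))), hfy,
        hσ, commutator_mul_central (gam_three_central h4Y (hf3 _ (D₀ m).2))
        (gam_two_comm h4Y (n i).2 (hf2 m))]⟩)
  exact ⟨φ, n, hφ⟩

end Core

/-! ### The Frattini subgroup as X^p γ_2(X) -/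

section Frattini

variable {p : ℕ} {X : Type*} [Group X]

variable (p X) in
/-- The subgroup `X ^ p γ_2(X)`, as the preimage of the `p`-th powers of the abelianization. -/
def powComm : Subgroup X :=
  (powMonoidHom p : Abelianization X →* Abelianization X).range.comap Abelianization.of

instance powComm_normal : (powComm p X).Normal := by unfold powComm; infer_instance

theorem gam_two_le_powComm : gam X 2 ≤ powComm p X := fun g hg =>
  ⟨1, by rw [map_one, (of_eq_one_iff X g).2 hg]⟩

theorem exists_of_mem_powComm {g : X} (hg : g ∈ powComm p X) :
    ∃ h : X, ∃ n ∈ gam X 2, g = h ^ p * n := by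
  obtain ⟨a, ha⟩ := hg
  obtain ⟨h, rfl⟩ := QuotientGroup.mk_surjective a
  refine ⟨h, (h ^ p)⁻¹ * g, ?_, (mul_inv_cancel_left _ _).symm⟩
  rw [← of_eq_one_iff, map_mul, map_inv, map_pow, ← ha]
  exact inv_mul_cancel _

theorem index_powComm : (powComm p X).index =
    (powMonoidHom p : Abelianization X →* Abelianization X).range.index :=
  Subgroup.index_comap_of_surjective _ QuotientGroup.mk_surjective

variable [Fact p.Prime]

theorem isCoatom_of_index_eq_prime {K : Subgroup X} (hK : K.index = p) : IsCoatom K := by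
  have hp := (Fact.out : p.Prime)
  refine ⟨?_, fun L hL => ?_⟩
  · rintro rfl
    rw [Subgroup.index_top] at hK
    exact hp.one_lt.ne hK
  · have h := Subgroup.relIndex_mul_index hL.le
    rw [hK] at h
    rcases (Nat.dvd_prime hp).1 (Dvd.intro_left _ h) with h1 | h1
    · exact Subgroup.index_eq_one.1 h1
    · rw [h1] at h
      have h2 : K.relIndex L = 1 := Nat.eq_of_mul_eq_mul_right hp.pos (by rw [h, one_mul])
      exact absurd (Subgroup.relIndex_eq_one.1 h2) hL.not_ge

/-- A maximal subgroup of a finite p-group is normal of index p, so it contains all commutators and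
p-th powers. -/
theorem powComm_le_frattini [Finite X] (hX : IsPGroup p X) : powComm p X ≤ frattini X := by
  have hp := (Fact.out : p.Prime)
  refine le_iInf₂ fun M hM => ?_
  have hnil := hX.isNilpotent
  have hn : M.Normal := Subgroup.NormalizerCondition.normal_of_coatom M
    Group.normalizerCondition_of_isNilpotent hM
  obtain ⟨a, ha⟩ := (hX.to_subgroup M).exists_card_eq
  obtain ⟨b, hb⟩ := hX.exists_card_eq
  have hidx := M.card_mul_index
  have hne : M.index ≠ 1 := fun h => hM.1 (Subgroup.index_eq_one.1 h)
  have hlt : a < b := by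
    refine lt_of_le_of_ne ?_ ?_
    · refine (Nat.pow_dvd_pow_iff_le_right hp.one_lt).1 ?_
      rw [← ha, ← hb]; exact M.card_subgroup_dvd_card
    · rintro rfl
      rw [ha, hb] at hidx
      exact hne (Nat.eq_of_mul_eq_mul_left (pow_pos hp.pos a) (by rw [hidx, mul_one]))
  obtain ⟨K, hK, hMK⟩ := Sylow.exists_subgroup_card_pow_succ (n := a)
    (by rw [hb]; exact pow_dvd_pow p hlt) ha
  have hKtop : K = ⊤ := by
    refine hM.2 K (lt_of_le_of_ne hMK ?_)
    rintro rfl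
    rw [hK] at ha
    exact absurd (Nat.pow_right_injective hp.one_lt ha) (by lia)
  have hidx' : Nat.card (X ⧸ M) = p := by
    rw [hKtop, Subgroup.card_top] at hK
    rw [ha, hK, pow_succ] at hidx
    exact Nat.eq_of_mul_eq_mul_left (pow_pos hp.pos a) hidx
  have hcyc : IsCyclic (X ⧸ M) := isCyclic_of_prime_card hidx'
  have h2 : gam X 2 ≤ M := by
    refine Subgroup.commutator_le.2 fun g _ h _ => ?_
    rw [← QuotientGroup.eq_one_iff]
    change QuotientGroup.mk' M ⁅g, h⁆ = 1
    rw [map_commutatorElement, commutatorElement_eq_one_iff_mul_comm]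
    exact hcyc.isMulCommutative.is_comm.comm _ _
  intro g hg
  obtain ⟨h, n, hn', rfl⟩ := exists_of_mem_powComm hg
  refine mul_mem ?_ (h2 hn')
  rw [← QuotientGroup.eq_one_iff]
  change ((h : X ⧸ M)) ^ p = 1
  rw [← hidx']
  exact pow_card_eq_one'

end Frattini

/-! ### Generators lifting a basis of the abelianization -/

section Generators

variable {p : ℕ} [Fact p.Prime] {G : Type u} [Group G] [Finite G] (hG : IsPGroup p G)
include hG

theorem exists_abelianization_equiv :
    ∃ (ι : Type) (_ : Fintype ι) (e : ι → ℕ), (∀ i, 1 ≤ e i) ∧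
      Nonempty (Abelianization G ≃* ((i : ι) → Multiplicative (ZMod (p ^ e i)))) := by
  classical
  have hA : IsPGroup p (Abelianization G) :=
    hG.of_surjective Abelianization.of QuotientGroup.mk_surjective
  obtain ⟨ι, hι, n, hn, ⟨E⟩⟩ := CommGroup.equiv_prod_multiplicative_zmod_of_finite
    (Abelianization G)
  have h : ∀ i, ∃ e, n i = p ^ e := by
    intro i
    have hinj : Function.Injective (E.symm.toMonoidHom.comp
        (MonoidHom.mulSingle (fun i => Multiplicative (ZMod (n i))) i)) :=
      E.symm.injective.comp
        (Pi.mulSingle_injective (M := fun i => Multiplicative (ZMod (n i))) i)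
    have : NeZero (n i) := ⟨by have := hn i; lia⟩
    obtain ⟨e, he⟩ := (hA.of_injective _ hinj).exists_card_eq
    refine ⟨e, ?_⟩
    rw [← he, Nat.card_congr Multiplicative.toAdd, Nat.card_zmod]
  choose e he using h
  obtain rfl : n = fun i => p ^ e i := funext he
  refine ⟨ι, hι, e, fun i => ?_, ⟨E⟩⟩
  have := hn i
  by_contra h0
  have h1 : e i = 0 := by lia
  simp [h1] at this

omit hG [Finite G] in
theorem mem_powComm_iff {ι : Type} {e : ι → ℕ} (he : ∀ i, 1 ≤ e i)
    (E : Abelianization G ≃* ((i : ι) → Multiplicative (ZMod (p ^ e i)))) (g : G) :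
    g ∈ powComm p G ↔ ∀ i, ZMod.castHom (dvd_pow_self p (Nat.one_le_iff_ne_zero.1 (he i)))
      (ZMod p) (E (Abelianization.of g) i).toAdd = 0 := by
  constructor
  · rintro ⟨a, ha⟩ i
    rw [← ha, powMonoidHom_apply, map_pow, Pi.pow_apply, toAdd_pow, map_nsmul]
    simp
  · intro h
    have h1 : ∀ i, ∃ d : ZMod (p ^ e i), (E (Abelianization.of g) i).toAdd = p • d := by
      intro i
      have hpe : NeZero (p ^ e i) := ⟨pow_ne_zero _ (Fact.out : p.Prime).ne_zero⟩
      obtain ⟨m, hm⟩ : ∃ m : ℕ, (m : ZMod (p ^ e i)) = (E (Abelianization.of g) i).toAdd :=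
        ⟨_, ZMod.natCast_zmod_val _⟩
      have h2 := h i
      rw [← hm, map_natCast, ZMod.natCast_eq_zero_iff] at h2
      obtain ⟨d, rfl⟩ := h2
      exact ⟨d, by rw [← hm, nsmul_eq_mul, Nat.cast_mul]⟩
    choose d hd using h1
    refine ⟨E.symm fun i => Multiplicative.ofAdd (d i), ?_⟩
    apply E.injective
    rw [powMonoidHom_apply, map_pow, MulEquiv.apply_symm_apply]
    funext i
    apply Multiplicative.toAdd.injective
    rw [hd i]
    rfl

/-- Reducing the cyclic coordinates modulo p maps G onto a power of Z/p with kernel `powComm`; the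
kernel of each coordinate is a maximal subgroup. -/
theorem frattini_eq_and_index {ι : Type} [Fintype ι] {e : ι → ℕ} (he : ∀ i, 1 ≤ e i)
    (E : Abelianization G ≃* ((i : ι) → Multiplicative (ZMod (p ^ e i)))) :
    frattini G = powComm p G ∧ (powComm p G).index = p ^ Fintype.card ι := by
  classical
  let c : ∀ i, ZMod (p ^ e i) →+* ZMod p := fun i =>
    ZMod.castHom (dvd_pow_self p (Nat.one_le_iff_ne_zero.1 (he i))) (ZMod p)
  let θ : G →* (ι → Multiplicative (ZMod p)) := MonoidHom.pi fun i =>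
    ((c i).toAddMonoidHom.toMultiplicative.comp (Pi.evalMonoidHom _ i)).comp
      (E.toMonoidHom.comp Abelianization.of)
  have hθ : ∀ g i, (θ g i).toAdd = c i (E (Abelianization.of g) i).toAdd := fun _ _ => rfl
  have hker : θ.ker = powComm p G := by
    ext g
    rw [mem_powComm_iff he E, MonoidHom.mem_ker, funext_iff]
    rfl
  have hsurj : Function.Surjective θ := by
    intro v
    obtain ⟨g, hg⟩ := QuotientGroup.mk_surjective (E.symm fun i =>
      Multiplicative.ofAdd (((v i).toAdd.val : ℕ) : ZMod (p ^ e i)))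
    refine ⟨g, funext fun i => Multiplicative.toAdd.injective ?_⟩
    have hg' : Abelianization.of g = _ := hg
    rw [hθ, hg', MulEquiv.apply_symm_apply, toAdd_ofAdd, map_natCast, ZMod.natCast_zmod_val]
  constructor
  · refine le_antisymm ?_ (powComm_le_frattini hG)
    rw [← hker]
    intro g hg
    refine funext fun i => ?_
    have hs : Function.Surjective ((Pi.evalMonoidHom _ i).comp θ) :=
      (Function.surjective_eval i).comp hsurj
    have hidx : ((Pi.evalMonoidHom _ i).comp θ).ker.index = p := by
      rw [Subgroup.index_ker, MonoidHom.range_eq_top.2 hs, Subgroup.card_top,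
        Nat.card_congr Multiplicative.toAdd, Nat.card_zmod]
    exact frattini_le_coatom (isCoatom_of_index_eq_prime hidx) hg
  · rw [← hker, Subgroup.index_ker, MonoidHom.range_eq_top.2 hsurj, Subgroup.card_top,
      Nat.card_fun, Nat.card_congr Multiplicative.toAdd, Nat.card_zmod,
      Nat.card_eq_fintype_card]

/-- The x_i lift a basis of G/γ_2, which has rank 3 because |G : Φ(G)| = p^3. -/
theorem exists_generators (hΦ : (frattini G).index = p ^ 3) :
    (powComm p G).index = p ^ 3 ∧
    ∃ (x : Fin 3 → G) (e : Fin 3 → ℕ), (∀ i, 1 ≤ e i) ∧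
      Subgroup.closure (Set.range x) = ⊤ ∧ (∀ i, x i ^ p ^ e i ∈ gam G 2) ∧
      (∀ a : Fin 3 → ℤ, x 0 ^ a 0 * x 1 ^ a 1 * x 2 ^ a 2 ∈ gam G 2 →
        ∀ i, ((p ^ e i : ℕ) : ℤ) ∣ a i) ∧
      (∀ a : Fin 3 → ℕ, x 0 ^ a 0 * x 1 ^ a 1 * x 2 ^ a 2 ∈ powComm p G → ∀ i, p ∣ a i) := by
  classical
  obtain ⟨ι, hι, e, he, ⟨E⟩⟩ := exists_abelianization_equiv hG
  obtain ⟨hfr, hidx⟩ := frattini_eq_and_index hG he E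
  refine ⟨hfr ▸ hΦ, ?_⟩
  have hcard : Fintype.card ι = 3 :=
    Nat.pow_right_injective (Fact.out : p.Prime).one_lt (by
      change p ^ Fintype.card ι = p ^ 3
      rw [← hidx, ← hfr, hΦ])
  let s : ι ≃ Fin 3 := Fintype.equivFinOfCardEq hcard
  choose x hx using fun i : Fin 3 => QuotientGroup.mk_surjective
    (E.symm (Pi.mulSingle (s.symm i) (Multiplicative.ofAdd (1 : ZMod (p ^ e (s.symm i))))))
  have hEx : ∀ i j, (E (Abelianization.of (x i)) (s.symm j)).toAdd = if i = j then 1 else 0 := by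
    intro i j
    have : Abelianization.of (x i) = _ := hx i
    rw [this, MulEquiv.apply_symm_apply]
    split_ifs with hij
    · subst hij; simp
    · rw [Pi.mulSingle_eq_of_ne (fun h => hij (s.symm.injective h).symm)]; rfl
  have hEa : ∀ (a : Fin 3 → ℤ) j, (E (Abelianization.of
      (x 0 ^ a 0 * x 1 ^ a 1 * x 2 ^ a 2)) (s.symm j)).toAdd = (a j : ZMod (p ^ e (s.symm j))) := by
    intro a j
    rw [map_mul, map_mul, map_mul, map_mul, map_zpow, map_zpow, map_zpow, map_zpow, map_zpow,
      map_zpow, Pi.mul_apply, Pi.mul_apply, Pi.pow_apply, Pi.pow_apply, Pi.pow_apply, toAdd_mul,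
      toAdd_mul, toAdd_zpow, toAdd_zpow, toAdd_zpow, hEx, hEx, hEx]
    fin_cases j <;> simp
  have hof : ∀ g, g ∈ gam G 2 ↔ ∀ j, (E (Abelianization.of g) (s.symm j)).toAdd = 0 := by
    intro g
    rw [← of_eq_one_iff, ← E.map_eq_one_iff, funext_iff, ← s.symm.forall_congr_right]
    rfl
  refine ⟨x, fun i => e (s.symm i), fun i => he _, ?_, ?_, ?_, ?_⟩
  · refine frattini_nongenerating (eq_top_iff.2 fun g _ => ?_)
    let a : Fin 3 → ℤ := fun j => ((E (Abelianization.of g) (s.symm j)).toAdd.val : ℤ)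
    have h1 : (x 0 ^ a 0 * x 1 ^ a 1 * x 2 ^ a 2)⁻¹ * g ∈ gam G 2 := by
      rw [hof]
      intro j
      have hpe : NeZero (p ^ e (s.symm j)) := ⟨pow_ne_zero _ (Fact.out : p.Prime).ne_zero⟩
      rw [map_mul, map_inv, map_mul, map_inv, Pi.mul_apply, Pi.inv_apply, toAdd_mul, toAdd_inv,
        hEa]
      simp [a]
    have h2 : ∀ i, x i ∈ Subgroup.closure (Set.range x) :=
      fun i => Subgroup.subset_closure ⟨i, rfl⟩
    rw [← mul_inv_cancel_left (x 0 ^ a 0 * x 1 ^ a 1 * x 2 ^ a 2) g]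
    refine mul_mem (Subgroup.mem_sup_left ?_)
      (Subgroup.mem_sup_right (hfr ▸ gam_two_le_powComm h1))
    exact mul_mem (mul_mem (zpow_mem (h2 0) _) (zpow_mem (h2 1) _)) (zpow_mem (h2 2) _)
  · intro i
    rw [hof]
    intro j
    rw [map_pow, map_pow, Pi.pow_apply, toAdd_pow, hEx]
    split_ifs with hij
    · subst hij; simp
    · simp
  · intro a ha i
    have h1 := (hof _).1 ha i
    rw [hEa, ZMod.intCast_zmod_eq_zero_iff_dvd] at h1
    exact_mod_cast h1
  · intro a ha i
    have h1 := (mem_powComm_iff he E _).1 ha (s.symm i)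
    have h2 := hEa (fun i => (a i : ℤ)) i
    simp only [zpow_natCast, Int.cast_natCast] at h2
    rw [h2, map_natCast, ZMod.natCast_eq_zero_iff] at h1
    exact h1

end Generators

/-! ### Consequences of γ_2(G)^p γ_4(G) = 1, and centrality modulo γ_3 -/

section PowGam

variable {p : ℕ} {G : Type u} [Group G]

theorem PowGamTrivial.gam_four (h : PowGamTrivial G p) : gam G 4 = ⊥ :=
  eq_bot_iff.2 (le_sup_right.trans h.le)

theorem PowGamTrivial.pow_eq_one (h : PowGamTrivial G p) {n : G} (hn : n ∈ gam G 2) :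
    n ^ p = 1 := by
  have h1 : n ^ p ∈ powSubgroup p (gam G 2) := Subgroup.subset_closure ⟨n, hn, rfl⟩
  exact Subgroup.mem_bot.1 (h.le (Subgroup.mem_sup_left h1))

theorem card_eq_card_gam_two_mul :
    Nat.card G = Nat.card (gam G 2) * Nat.card (Abelianization G) :=
  (gam G 2).card_mul_index.symm

variable [Fact p.Prime]

/-- Since p is odd, p-th powers are central, and γ_2 ≤ Z_2; equality follows by comparing indices.
-/
theorem upperCentralSeries_two_eq_powComm (hp2 : p ≠ 2) (h : PowGamTrivial G p)
    (hidx : (powComm p G).index = p ^ 3)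
    (hZ : (Subgroup.upperCentralSeries G 2).index = p ^ 3) :
    Subgroup.upperCentralSeries G 2 = powComm p G := by
  have hle : powComm p G ≤ Subgroup.upperCentralSeries G 2 := by
    intro g hg
    obtain ⟨a, n, hn, rfl⟩ := exists_of_mem_powComm hg
    have h1 := pow_mem_center (e := 1) Fact.out hp2 le_rfl h.gam_four
      (fun n hn => h.pow_eq_one hn) a
    rw [pow_one] at h1
    refine mul_mem ?_ ?_
    · refine Subgroup.upperCentralSeries_mono G (show 1 ≤ 2 by lia) ?_
      rwa [Subgroup.upperCentralSeries_one]
    · rw [Subgroup.mem_upperCentralSeries_succ_iff]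
      intro s
      rw [Subgroup.upperCentralSeries_one, Subgroup.mem_center_iff]
      exact fun t => (gam_three_central h.gam_four (commutator_mem_gam_three' hn s) t).symm
  have h1 := Subgroup.relIndex_mul_index hle
  rw [hidx, hZ] at h1
  have h2 : (powComm p G).relIndex (Subgroup.upperCentralSeries G 2) = 1 :=
    Nat.eq_of_mul_eq_mul_right (pow_pos (Fact.out : p.Prime).pos 3) (by rw [h1, one_mul])
  exact le_antisymm (Subgroup.relIndex_eq_one.1 h2) hle

variable [Finite G]

theorem PowGamTrivial.embS_injective (h : PowGamTrivial G p) (hG : IsPGroup p G) :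
    Function.Injective (embS hG) :=
  SmallGroupAlgebra.embS_injective hG fun _ hn h1 =>
    emb_injOn (fun _ ha _ hb => gam_two_comm h.gam_four ha hb) (fun _ ha => h.pow_eq_one ha) hn
      (congrArg (val p G) h1)

/-- γ_2(G) always maps onto γ_2(S), so equality of orders gives injectivity on γ_2(G). -/
theorem embS_injective_of_card (hG : IsPGroup p G)
    (h : Nat.card (gam G 2) = Nat.card (gam (SmallUnits p G) 2)) :
    Function.Injective (embS hG) := by
  refine SmallGroupAlgebra.embS_injective hG fun n hn h1 => ?_
  rw [gam_two_eq hG] at h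
  have hsurj := (embS hG).subgroupMap_surjective (gam G 2)
  have hbij := (Nat.bijective_iff_surjective_and_card _).2 ⟨hsurj, h⟩
  have h2 : (⟨n, hn⟩ : gam G 2) = 1 := hbij.1 (by rw [map_one]; exact Subtype.ext h1)
  exact congrArg Subtype.val h2

variable (hG : IsPGroup p G)

/-- The units that are central modulo `γ_3`. -/
def centralModThree (S : Type*) [Group S] : Subgroup S :=
  Subgroup.upperCentralSeriesStep (gam S 3)

instance centralModThree_normal (S : Type*) [Group S] : (centralModThree S).Normal := by
  rw [centralModThree, Subgroup.upperCentralSeriesStep_eq_comap_center]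
  infer_instance

theorem gam_two_le_centralModThree {S : Type*} [Group S] : gam S 2 ≤ centralModThree S :=
  fun _ hn s => commutator_mem_gam_three' hn s

-- For a p-th power, a^p - 1 = (a - 1)^p lies in I².
include hG in
theorem embS_mem_centralModThree {g : G} (hg : g ∈ powComm p G) :
    embS hG g ∈ centralModThree (SmallUnits p G) := by
  obtain ⟨a, n, hn, rfl⟩ := exists_of_mem_powComm hg
  rw [map_mul]
  refine mul_mem ?_ (gam_two_le_centralModThree ?_)
  · intro s
    refine commutator_mem_gam_three hG ?_ s
    have hp := (Fact.out : p.Prime).two_le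
    have ha : emb p G a - 1 ∈ ker p G := by
      rw [RingHom.mem_ker, map_sub, eps_emb, map_one, sub_self]
    have h1 : val p G (embS hG (a ^ p)) - 1 = (emb p G a - 1) * (emb p G a - 1) ^ (p - 1) := by
      rw [val_embS, map_pow, ← pow_succ', Nat.sub_add_cancel (by lia),
        sub_pow_char_of_commute p (h := Commute.one_right _), one_pow]
    rw [h1]
    refine Ideal.mul_mem_mul ha ?_
    rw [RingHom.mem_ker, map_pow, RingHom.mem_ker.1 ha, zero_pow (by lia)]
  · rw [gam_two_eq hG]
    exact Subgroup.mem_map_of_mem _ hn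

end PowGam

theorem commutator_inv_mul_mem {S : Type*} [Group S] {a b w z : S}
    (hw : w ∈ centralModThree S) (hz : z ∈ centralModThree S) :
    ⁅a * w, b * z⁆⁻¹ * ⁅a, b⁆ ∈ gam S 3 := by
  let π := QuotientGroup.mk' (gam S 3)
  have hc : ∀ {w}, w ∈ centralModThree S → ∀ s, π w * s = s * π w := by
    intro w hw s
    obtain ⟨s, rfl⟩ := QuotientGroup.mk'_surjective _ s
    rw [← commutatorElement_eq_one_iff_mul_comm, ← map_commutatorElement]
    exact (QuotientGroup.eq_one_iff _).2 (hw s)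
  have h : π ⁅a * w, b * z⁆ = π ⁅a, b⁆ := by
    rw [map_commutatorElement, map_commutatorElement, map_mul, map_mul,
      commutator_mul_central (hc hw) (hc hz _)]
  exact QuotientGroup.eq.1 h

/-! ### Comparing G and H through the isomorphism of unit groups -/

section Final

variable {p : ℕ} [Fact p.Prime] {G : Type u} [Group G] [Finite G] (hG : IsPGroup p G)
  {H : Type v} [Group H] [Finite H] (hH : IsPGroup p H)
  (F : SmallUnits p G ≃* SmallUnits p H)

/-- A homomorphism `φ` that agrees with the given isomorphism of the unit groups on generators,
up to units that are central modulo `γ_3`, is surjective. -/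
theorem surjective_of_agree (hinjG : Function.Injective (embS hG)) (h4 : gam G 4 = ⊥)
    {x : Fin 3 → G} (hx : Subgroup.closure (Set.range x) = ⊤)
    (hZ : (Subgroup.upperCentralSeries G 2).index = p ^ 3)
    (hidx : (powComm p H).index = p ^ 3) (φ : G →* H)
    (hφ : ∀ i, (F (embS hG (x i)))⁻¹ * embS hH (φ (x i)) ∈ centralModThree (SmallUnits p H)) :
    Function.Surjective φ := by
  let U := centralModThree (SmallUnits p H)
  have hagree : ((QuotientGroup.mk' U).comp F.toMonoidHom).comp (embS hG) =
      ((QuotientGroup.mk' U).comp (embS hH)).comp φ := by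
    refine MonoidHom.eq_of_eqOn_dense hx ?_
    rintro _ ⟨i, rfl⟩
    exact QuotientGroup.eq.2 (hφ i)
  let Ψ : G →* H ⧸ powComm p H := (QuotientGroup.mk' (powComm p H)).comp φ
  -- If φ(g) ∈ H^p γ_2(H), then F(g) is central modulo γ_3(S_H). Pulling back, all [g, s] lie in
  -- γ_3(G), which is central.
  have hker : Ψ.ker ≤ Subgroup.upperCentralSeries G 2 := by
    intro g hg
    have h1 : φ g ∈ powComm p H := (QuotientGroup.eq_one_iff _).1 hg
    have h2 : F (embS hG g) ∈ U := by
      rw [← QuotientGroup.eq_one_iff]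
      refine (DFunLike.congr_fun hagree g).trans ?_
      exact (QuotientGroup.eq_one_iff _).2 (embS_mem_centralModThree hH h1)
    rw [Subgroup.mem_upperCentralSeries_succ_iff]
    intro s
    have h3 := h2 (F (embS hG s))
    rw [← map_commutatorElement, mulEquiv_mem_gam_iff, gam_three_eq hG, ← map_commutatorElement,
      Subgroup.mem_map_iff_mem hinjG] at h3
    rw [Subgroup.upperCentralSeries_one, Subgroup.mem_center_iff]
    exact fun t => (gam_three_central h4 h3 t).symm
  -- The image has order at least |G : Z_2(G)| = p^3, the order of the target.
  have hsurj : Function.Surjective Ψ := by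
    rw [← MonoidHom.range_eq_top]
    refine Subgroup.eq_top_of_le_card _ ?_
    have h1 : Nat.card (H ⧸ powComm p H) = p ^ 3 := hidx
    rw [← Subgroup.index_ker, h1, ← hZ]
    exact Nat.le_of_dvd (Nat.pos_of_ne_zero Subgroup.index_ne_zero_of_finite)
      (Subgroup.index_dvd_of_le hker)
  rw [← MonoidHom.range_eq_top]
  refine frattini_nongenerating (eq_top_iff.2 fun h _ => ?_)
  obtain ⟨g, hg⟩ := hsurj h
  have h1 : (φ g)⁻¹ * h ∈ powComm p H := QuotientGroup.eq.1 hg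
  rw [← mul_inv_cancel_left (φ g) h]
  exact mul_mem (Subgroup.mem_sup_left ⟨g, rfl⟩)
    (Subgroup.mem_sup_right (powComm_le_frattini hH h1))

/-- The map between the derived subgroups induced by an isomorphism of the unit groups. -/
theorem exists_derived_map (hinjH : Function.Injective (embS hH)) :
    ∃ f : gam G 2 →* H, ∀ n, embS hH (f n) = F (embS hG n) := by
  have hmem : ∀ n : gam G 2, F (embS hG n) ∈ (embS hH).range := by
    intro n
    have h1 : F (embS hG n) ∈ gam (SmallUnits p H) 2 := by
      rw [mulEquiv_mem_gam_iff, gam_two_eq hG]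
      exact Subgroup.mem_map_of_mem _ n.2
    rw [gam_two_eq hH] at h1
    exact Subgroup.map_le_range _ _ h1
  let F₀ : gam G 2 →* (embS hH).range :=
    ((F.toMonoidHom.comp (embS hG)).comp (gam G 2).subtype).codRestrict _ hmem
  let E := MonoidHom.ofInjective hinjH
  refine ⟨E.symm.toMonoidHom.comp F₀, fun n => ?_⟩
  have h : E (E.symm (F₀ n)) = F₀ n := E.apply_symm_apply _
  exact congrArg Subtype.val h

end Final

end SmallGroupAlgebra

open SmallGroupAlgebra in
theorem mainTheorem7 (p : ℕ) [Fact p.Prime] (hp : p ≠ 2)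
    (G : Type u) [Group G] [Finite G] (hG : IsPGroup p G)
    (hpow : SmallGroupAlgebra.PowGamTrivial G p)
    (hΦ : (frattini G).index = p ^ 3)
    (hZ : (Subgroup.upperCentralSeries G 2).index = p ^ 3)
    (hcase : (SmallGroupAlgebra.capGam G).relIndex (SmallGroupAlgebra.gam G 2) = p ^ 3 ∨
      Nat.card (SmallGroupAlgebra.gam G 3) = p)
    (H : Type v) [Group H] [Finite H] (hH : IsPGroup p H)
    (hHG : SmallGroupAlgebra.PowGamTrivial H p ∨ Nat.card H = Nat.card G)
    (hS : Nonempty (SmallGroupAlgebra.SmallUnits p G ≃* SmallGroupAlgebra.SmallUnits p H)) :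
    Nonempty (G ≃* H) := by
  obtain ⟨F⟩ := hS
  obtain ⟨hc2, hcA, hcP⟩ := card_eq_of_smallUnits_equiv hG hH F
  have hinjG := hpow.embS_injective hG
  have h4G := hpow.gam_four
  have hcG : Nat.card (gam G 2) = Nat.card (gam (SmallUnits p G) 2) := by
    rw [gam_two_eq hG]
    exact (Nat.card_congr ((gam G 2).equivMapOfInjective _ hinjG).toEquiv)
  have hinjH : Function.Injective (embS hH) := by
    rcases hHG with h | h
    · exact h.embS_injective hH
    -- The abelianizations have equal order, so |H| = |G| gives |γ_2(H)| = |γ_2(G)| = |γ_2(S_G)| =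
    -- |γ_2(S_H)|.
    · refine embS_injective_of_card hH ?_
      rw [card_eq_card_gam_two_mul, card_eq_card_gam_two_mul (G := G), hcA, hcG, hc2] at h
      exact Nat.eq_of_mul_eq_mul_right Nat.card_pos h
  have hcH : Nat.card (gam H 2) = Nat.card (gam (SmallUnits p H) 2) := by
    rw [gam_two_eq hH]
    exact (Nat.card_congr ((gam H 2).equivMapOfInjective _ hinjH).toEquiv)
  have hcard : Nat.card G = Nat.card H := by
    rw [card_eq_card_gam_two_mul, card_eq_card_gam_two_mul (G := H), hcA, hcG, hc2, hcH]
  have hmemH : ∀ {i : ℕ}, gam (SmallUnits p G) i = (gam G i).map (embS hG) →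
      gam (SmallUnits p H) i = (gam H i).map (embS hH) → ∀ {g : G} {h : H},
      embS hH h = F (embS hG g) → (h ∈ gam H i ↔ g ∈ gam G i) := by
    intro i h1 h2 g h hgh
    rw [← Subgroup.mem_map_iff_mem hinjH, ← h2, hgh, mulEquiv_mem_gam_iff, h1,
      Subgroup.mem_map_iff_mem hinjG]
  have h4H : gam H 4 = ⊥ := by
    rw [eq_bot_iff]
    intro h hh
    have h1 : embS hH h ∈ gam (SmallUnits p H) 4 := by
      rw [gam_four_eq hH]; exact Subgroup.mem_map_of_mem _ hh
    rw [← F.apply_symm_apply (embS hH h), mulEquiv_mem_gam_iff, gam_four_eq hG, h4G,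
      Subgroup.map_bot, Subgroup.mem_bot, F.symm.map_eq_one_iff] at h1
    exact Subgroup.mem_bot.2 (hinjH (by rw [h1, map_one]))
  have hexpH : ∀ n ∈ gam H 2, n ^ p = 1 := fun n hn =>
    hinjH (val_injective (by rw [map_one, map_one]; exact emb_pow_prime hn))
  obtain ⟨hidxG, x, e, he, hx, hxe, hind, hR⟩ := exists_generators hG hΦ
  have hidxH : (powComm p H).index = p ^ 3 := by
    rw [← hidxG, index_powComm, index_powComm]
    have h1 := (powMonoidHom p : Abelianization G →* Abelianization G).range.card_mul_index
    have h2 := (powMonoidHom p : Abelianization H →* Abelianization H).range.card_mul_index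
    rw [hcA, ← h2, hcP] at h1
    exact (Nat.eq_of_mul_eq_mul_left Nat.card_pos h1).symm
  have hex : ∀ i, ∃ (y : H) (w : SmallUnits p H), F (embS hG (x i)) = embS hH y * w ∧
      val p H w - 1 ∈ ker p H * ker p H ∧
      F (embS hG (x i)) ^ p ^ e i = embS hH (y ^ p ^ e i) := by
    intro i
    refine exists_eq_embS_mul hH hp h4H (he i) ?_
    rw [← map_pow, ← map_pow, mulEquiv_mem_gam_iff, gam_two_eq hG]
    exact Subgroup.mem_map_of_mem _ (hxe i)
  choose y w hyw hw hyp using hex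
  have hwc : ∀ i, w i ∈ centralModThree (SmallUnits p H) := fun i =>
    commutator_mem_gam_three hH (hw i)
  obtain ⟨f, hf⟩ := exists_derived_map hG hH F hinjH
  let _ : CommGroup (gam G 3) := { (inferInstance : Group (gam G 3)) with
    mul_comm := fun a b => Subtype.ext (gam_three_central h4G a.2 b) }
  let _ : Module (ZMod p) (Additive (gam G 3)) := AddCommGroup.zmodModule fun a => by
    have : (Additive.toMul a) ^ p = 1 :=
      Subtype.ext (hpow.pow_eq_one (gam_three_le_gam_two (Additive.toMul a).2))
    exact this
  let τ : gam G 3 ≃* Multiplicative (Additive (gam G 3)) :=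
    { toFun := fun a => Multiplicative.ofAdd (Additive.ofMul a)
      invFun := fun a => Additive.toMul (Multiplicative.toAdd a)
      left_inv := fun _ => rfl
      right_inv := fun _ => rfl
      map_mul' := fun _ _ => rfl }
  have hT : LinearIndependent (ZMod p) (brkComm h4G x τ) ∨
      ((∃ t₀ : Additive (gam G 3), ∀ t, ∃ a : ZMod p, t = a • t₀) ∧
      ∀ a : Fin 3 → ZMod p,
        (∀ i j, a i • brkComm h4G x τ j = a j • brkComm h4G x τ i) → a = 0) := by
    refine hcase.imp (linearIndependent_brkComm h4G x τ hx) fun h =>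
      ⟨exists_smul_of_card_eq h, eq_zero_of_brkComm h4G x τ hx fun a ha => hR a ?_⟩
    rwa [← upperCentralSeries_two_eq_powComm hp hpow hidxG hZ]
  obtain ⟨φ, n, hφ⟩ := exists_monoidHom_of_derived hp h4G h4H (fun _ hn => hpow.pow_eq_one hn)
    hexpH x hx e he hxe hind τ hT y f
    (fun m => (hmemH (gam_two_eq hG) (gam_two_eq hH) (hf m)).2 m.2)
    (fun m hm => (hmemH (gam_three_eq hG) (gam_three_eq hH) (hf m)).2 hm)
    -- This identity is exact because w_i commutes with γ_2(H).
    (fun m i => hinjH (by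
      have hm2 : f m ∈ gam H 2 := (hmemH (gam_two_eq hG) (gam_two_eq hH) (hf m)).2 m.2
      rw [hf, map_commutatorElement, hf]
      change F (embS hG ⁅(m : G), x i⁆) = _
      have h1 := commutator_mul_central (a := F (embS hG m)) (z := 1) (b := embS hH (y i))
        (m := w i) (fun s => by rw [one_mul, mul_one])
        (by rw [← hf]; exact (commute_embS hH h4H (hw i) hm2).eq)
      rw [mul_one, ← hyw] at h1
      rw [map_commutatorElement, map_commutatorElement, h1]))
    -- Here w_i and w_j are only central modulo γ_3, so an error m ∈ γ_3(G) remains.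
    (fun i j => by
      have h1 := commutator_inv_mul_mem (a := embS hH (y i)) (b := embS hH (y j)) (hwc i) (hwc j)
      rw [← hyw, ← hyw] at h1
      obtain ⟨d, hd⟩ := F.surjective
        (⁅F (embS hG (x i)), F (embS hG (x j))⁆⁻¹ * ⁅embS hH (y i), embS hH (y j)⁆)
      rw [← hd, mulEquiv_mem_gam_iff, gam_three_eq hG] at h1
      obtain ⟨m, hm, rfl⟩ := h1
      refine ⟨⟨m, hm⟩, hinjH ?_⟩
      rw [hf, map_commutatorElement]
      change F (embS hG (⁅x i, x j⁆ * m)) = _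
      rw [map_mul, map_mul, hd, map_commutatorElement, map_commutatorElement,
        mul_inv_cancel_left])
    (fun i => hinjH (by rw [hf, ← hyp, map_pow, map_pow]))
  have hsurj : Function.Surjective φ := by
    refine surjective_of_agree hG hH F hinjG h4G hx hZ hidxH φ fun i => ?_
    rw [hyw, hφ, map_mul, mul_inv_rev, mul_assoc, inv_mul_cancel_left]
    refine mul_mem (inv_mem (hwc i)) (gam_two_le_centralModThree ?_)
    rw [gam_two_eq hH]
    exact Subgroup.mem_map_of_mem _ (n i).2
  exact ⟨MulEquiv.ofBijective φ ((Nat.bijective_iff_surjective_and_card _).2 ⟨hsurj, hcard⟩)⟩
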